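/- Let $\mathcal F$ be the open region of the $(t_0,t_1)$-plane bounded by the segments $\{(t_0,0):0\le t_0\le 1/8\}$ and $\{(0,t_1):0\le t_1\le 1/4\}$ and by the arc $t_0=4s^3-6s^4,\ t_1=4s^3-3s^2+\tfrac14,\ 0\le s\le \tfrac12$. Let $(t_0,t_1)\in\mathcal F$. Let $r=r(t_0,t_1)$ be the smallest positive root of $$p(x)=128x^{10}-124x^8+(64t_0-16t_1+36)x^6+(16t_1^2+8t_1-28t_0-3)x^4+t_0(2-8t_1)x^2+t_0^2,$$ and put $$a_0=\frac{1-4r^2-\sqrt{(1-4r^2)^2-4t_1}}{2},\qquad h(w)=rw+a_0+\frac{2a_0r}{w}+\frac{r^2}{w^2}.$$ Let $\Omega$ be the interior of the closed curve $h(\partial\mathbb D)$, where $\partial\mathbb D=\{w\in\mathbb C:|w|=1\}$ (that is, the set of points off the curve whose connected component in the complement of the curve is bounded). Let $\mu_0$ be the measure $d\mu_0=\frac{1}{\pi t_0}\chi_\Omega\,dA$, with $dA$ the Lebesgue measure on $\mathbb C$, let $U^{\mu_0}(z)=\int\log\frac{1}{|s-z|}\,d\mu_0(s)$, and let $$\mathcal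 V(z)=\frac1{t_0}\bigl(|z|^2-2\operatorname{Re}V(z)\bigr),\qquad V(z)=\frac{z^3}{3}+t_1z .$$ Then the integral defining $U^{\mu_0}(z)$ converges absolutely for every $z\in\mathbb C$, and there exist an open neighborhood $D$ of $\overline\Omega$ and a constant $l\in\mathbb R$ such that $$2U^{\mu_0}(z)+\mathcal V(z)=l\quad\text{for } z\in\overline\Omega,\qquad 2U^{\mu_0}(z)+\mathcal V(z)>l\quad\text{for } z\in D\setminus\overline\Omega .$$ -/

import Mathlib

open MeasureTheory

noncomputable section

namespace CubicModel

/-- The phase domain in the `(t₀, t₁)`-plane: the open region enclosed by the two coordinate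
segments `[0, 1/8] × {0}`, `{0} × [0, 1/4]` and the arc
`t₀ = 4 s³ - 6 s⁴`, `t₁ = 4 s³ - 3 s² + 1/4`, `0 ≤ s ≤ 1/2`.
On `[0, 1/2]` the first coordinate of the arc increases strictly from `0` to `1/8` and the second
decreases strictly from `1/4` to `0`, so the enclosed region consists of the points of the open
positive quadrant that lie strictly to the left of the point of the arc at the same height. -/
def phaseDomain : Set (ℝ × ℝ) :=
  {t | 0 < t.1 ∧ 0 < t.2 ∧
    ∃ s ∈ Set.Icc (0 : ℝ) (1 / 2),
      t.2 = 4 * s ^ 3 - 3 * s ^ 2 + 1 / 4 ∧ t.1 < 4 * s ^ 3 - 6 * s ^ 4}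

/-- The polynomial of degree `10` whose smallest positive root is the leading coefficient of the
rational parametrization. -/
def p (t₀ t₁ x : ℝ) : ℝ :=
  128 * x ^ 10 - 124 * x ^ 8 + (64 * t₀ - 16 * t₁ + 36) * x ^ 6
    + (16 * t₁ ^ 2 + 8 * t₁ - 28 * t₀ - 3) * x ^ 4 + t₀ * (2 - 8 * t₁) * x ^ 2 + t₀ ^ 2

/-- The smallest positive root of `p t₀ t₁` (the set of positive roots is finite, so the infimum
is its least element as soon as there is a positive root). -/
def r (t₀ t₁ : ℝ) : ℝ := sInf {x : ℝ | 0 < x ∧ p t₀ t₁ x = 0}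

def a₀ (t₀ t₁ : ℝ) : ℝ :=
  (1 - 4 * r t₀ t₁ ^ 2 - Real.sqrt ((1 - 4 * r t₀ t₁ ^ 2) ^ 2 - 4 * t₁)) / 2

/-- The rational function `h(w) = r w + a₀ + 2 a₀ r / w + r² / w²`. -/
def h (t₀ t₁ : ℝ) (w : ℂ) : ℂ :=
  (r t₀ t₁ : ℂ) * w + (a₀ t₀ t₁ : ℂ) + 2 * (a₀ t₀ t₁ : ℂ) * (r t₀ t₁ : ℂ) / w
    + (r t₀ t₁ : ℂ) ^ 2 / w ^ 2

/-- The curve `h(∂𝔻)`. -/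
def boundaryCurve (t₀ t₁ : ℝ) : Set ℂ := h t₀ t₁ '' Metric.sphere (0 : ℂ) 1

/-- The interior of the closed curve `h(∂𝔻)`: the points off the curve whose connected component
in the complement of the curve is bounded. -/
def Ω (t₀ t₁ : ℝ) : Set ℂ :=
  {z | z ∉ boundaryCurve t₀ t₁ ∧
    Bornology.IsBounded (connectedComponentIn (boundaryCurve t₀ t₁)ᶜ z)}

/-- The measure `dμ₀ = (1 / (π t₀)) χ_Ω dA`. -/
def μ₀ (t₀ t₁ : ℝ) : Measure ℂ :=
  ENNReal.ofReal (1 / (Real.pi * t₀)) • (volume : Measure ℂ).restrict (Ω t₀ t₁)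

/-- The logarithmic potential `U^ν(z) = ∫ log (1 / |s - z|) dν(s)`. -/
def logPotential (ν : Measure ℂ) (z : ℂ) : ℝ := ∫ s, Real.log (1 / ‖s - z‖) ∂ν

/-- The cubic polynomial `V(z) = z³ / 3 + t₁ z`. -/
def V (t₁ : ℝ) (z : ℂ) : ℂ := z ^ 3 / 3 + (t₁ : ℂ) * z

/-- The external field `𝒱(z) = (|z|² - 2 Re V(z)) / t₀`. -/
def externalField (t₀ t₁ : ℝ) (z : ℂ) : ℝ := 1 / t₀ * (‖z‖ ^ 2 - 2 * (V t₁ z).re)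

end CubicModel

end

noncomputable section

namespace CubicModel

open scoped ComplexConjugate Topology
open Complex (I)

/-! Write `a` for `a₀`. The argument rests on `0 < r`, `0 < a`, `a + r < 1/2` and `t₁ = a - a² -
4ar²`. Eliminating `a` from this relation and `t₀ = r²(1 - 2r² - 4a²)` gives `p`, a product over
both roots `a` of the quadratic. `param_spec` recovers the relations and the bound from the least
root.

Replacing `1/w` by `conj w` turns `h` on the disc into the harmonic map `harmMap`. Glued to `h`
outside the disc, it is `a + r (w + g w)` with `g` Lipschitz of constant `2a + 2r < 1`, hence a
homeomorphism of the plane. So `h` maps the circle onto a Jordan curve whose interior `Ω` is the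
image of the disc.

Green's formula (`setIntegral_log_eq`) turns the area integral of `log |s - z|` into the integral of
`conj (h - z) (log |h - z| - 1/2) dh` over the circle. There the factors other than the logarithmic
one form a Laurent polynomial, and `log |h - z|` is `log r` plus the sum of `log |1 - b/w|` over the
three solutions `b` of `h b = z`. For `z ∈ Ω` all three lie in the disc, the Fourier coefficients
are power sums of the `b`, polynomial in `z` by Newton's identities, and the formula for `t₁` makes
the total potential constant. Continuity carries this to the closure.

At `z = h(ρu)` with `ρ > 1`, `|u| = 1`, exactly one solution leaves the disc; reflecting it in the
circle gives a formula for the excess over the constant. Its `ρ`-derivative is `2 Re ((conj h(ρu) -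
h(1/(ρu))) u h'(ρu))`, which is `ρ - 1/ρ` times a factor equal to `2|h'(u)|² > 0` at `ρ = 1`.
Compactness of the circle then gives a uniform collar where the excess is positive. -/

/-! ### Recovering the parameters from the least positive root -/

lemma p_factor {t₀ t₁ x a b : ℝ} (hs : a + b = 1 - 4 * x ^ 2) (hp : a * b = t₁) :
    p t₀ t₁ x = (t₀ - x ^ 2 * (1 - 2 * x ^ 2 - 4 * a ^ 2)) *
      (t₀ - x ^ 2 * (1 - 2 * x ^ 2 - 4 * b ^ 2)) := by
  have hb : b = 1 - 4 * x ^ 2 - a := by linarith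
  subst hb; subst hp
  unfold p; ring

/-- The smaller root of `a ^ 2 - (1 - 4 * x ^ 2) * a + t₁`. -/
def smallRoot (t₁ x : ℝ) : ℝ := (1 - 4 * x ^ 2 - Real.sqrt ((1 - 4 * x ^ 2) ^ 2 - 4 * t₁)) / 2

def largeRoot (t₁ x : ℝ) : ℝ := (1 - 4 * x ^ 2 + Real.sqrt ((1 - 4 * x ^ 2) ^ 2 - 4 * t₁)) / 2

lemma smallRoot_add_largeRoot (t₁ x : ℝ) : smallRoot t₁ x + largeRoot t₁ x = 1 - 4 * x ^ 2 := by
  unfold smallRoot largeRoot; ring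

lemma smallRoot_mul_largeRoot {t₁ x : ℝ} (h : 0 ≤ (1 - 4 * x ^ 2) ^ 2 - 4 * t₁) :
    smallRoot t₁ x * largeRoot t₁ x = t₁ := by
  have := Real.sq_sqrt h
  unfold smallRoot largeRoot; linear_combination (-1 / 4) * this

lemma smallRoot_le_largeRoot (t₁ x : ℝ) : smallRoot t₁ x ≤ largeRoot t₁ x := by
  have := Real.sqrt_nonneg ((1 - 4 * x ^ 2) ^ 2 - 4 * t₁)
  unfold smallRoot largeRoot; linarith

/-- The value of `t₀` that belongs to the leading coefficient `x`. -/
def areaParam (t₁ x : ℝ) : ℝ := x ^ 2 * (1 - 2 * x ^ 2 - 4 * smallRoot t₁ x ^ 2)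

lemma continuous_areaParam (t₁ : ℝ) : Continuous (areaParam t₁) := by
  unfold areaParam smallRoot; fun_prop

lemma p_eq_zero_of_areaParam_eq {t₀ t₁ x : ℝ} (h : 0 ≤ (1 - 4 * x ^ 2) ^ 2 - 4 * t₁)
    (hx : areaParam t₁ x = t₀) : p t₀ t₁ x = 0 := by
  rw [p_factor (smallRoot_add_largeRoot t₁ x) (smallRoot_mul_largeRoot h)]
  unfold areaParam at hx
  rw [hx]; ring

/-- One of the two factors of `p` vanishes. Since `0 ≤ smallRoot ≤ largeRoot`, the large root yields
the smaller area value, so the bound holds in both cases. -/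
lemma le_areaParam_of_root {t₀ t₁ x : ℝ} (h : 0 ≤ (1 - 4 * x ^ 2) ^ 2 - 4 * t₁)
    (hx : 4 * x ^ 2 ≤ 1) (h₁ : 0 ≤ t₁) (hp : p t₀ t₁ x = 0) : t₀ ≤ areaParam t₁ x := by
  rw [p_factor (smallRoot_add_largeRoot t₁ x) (smallRoot_mul_largeRoot h)] at hp
  rcases mul_eq_zero.1 hp with h0 | h0
  · unfold areaParam; linarith
  · have hsm : 0 ≤ smallRoot t₁ x := by
      have : Real.sqrt ((1 - 4 * x ^ 2) ^ 2 - 4 * t₁) ≤ 1 - 4 * x ^ 2 := by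
        rw [Real.sqrt_le_left (by linarith)]; linarith
      unfold smallRoot; linarith
    have h2 : smallRoot t₁ x ^ 2 ≤ largeRoot t₁ x ^ 2 :=
      pow_le_pow_left₀ hsm (smallRoot_le_largeRoot t₁ x) 2
    have := mul_le_mul_of_nonneg_left h2 (sq_nonneg x)
    unfold areaParam; nlinarith

lemma isLeast_r {t₀ t₁ x₀ : ℝ} (ht₀ : 0 < t₀) (hx₀ : 0 < x₀) (hp : p t₀ t₁ x₀ = 0) :
    IsLeast {x : ℝ | 0 < x ∧ p t₀ t₁ x = 0} (r t₀ t₁) := by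
  -- The value at `0` is `t₀² ≠ 0`, so the positive roots form a closed set and the infimum is
  -- attained.
  have hS : {x : ℝ | 0 < x ∧ p t₀ t₁ x = 0} = {x : ℝ | 0 ≤ x ∧ p t₀ t₁ x = 0} := by
    ext x
    refine ⟨fun h => ⟨h.1.le, h.2⟩, fun h => ⟨h.1.lt_of_ne ?_, h.2⟩⟩
    rintro rfl
    have := h.2
    simp only [p] at this
    nlinarith
  have hbdd : BddBelow {x : ℝ | 0 < x ∧ p t₀ t₁ x = 0} := ⟨0, fun x hx => hx.1.le⟩
  refine ⟨?_, fun x hx => csInf_le hbdd hx⟩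
  refine IsClosed.csInf_mem ?_ ⟨x₀, hx₀, hp⟩ hbdd
  rw [hS]
  have hc : Continuous (p t₀ t₁) := by unfold p; fun_prop
  exact (isClosed_le continuous_const continuous_id).inter (isClosed_eq hc continuous_const)

/-- The parameters `(r, a₀)` of a point of the phase domain. -/
theorem param_spec {t₀ t₁ : ℝ} (ht : (t₀, t₁) ∈ phaseDomain) :
    0 < r t₀ t₁ ∧ 0 < a₀ t₀ t₁ ∧ a₀ t₀ t₁ + r t₀ t₁ < 1 / 2 ∧
      t₁ = a₀ t₀ t₁ - a₀ t₀ t₁ ^ 2 - 4 * a₀ t₀ t₁ * r t₀ t₁ ^ 2 ∧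
      t₀ = r t₀ t₁ ^ 2 * (1 - 2 * r t₀ t₁ ^ 2 - 4 * a₀ t₀ t₁ ^ 2) := by
  obtain ⟨h0, h1, s, ⟨hs0, hs1⟩, hst, hs⟩ := ht
  simp only at h0 h1 hst hs
  have hs0' : 0 < s := hs0.lt_of_ne (by rintro rfl; norm_num at hs; linarith)
  have hs1' : s < 1 / 2 := hs1.lt_of_ne (by rintro rfl; norm_num at hst; linarith)
  have hdisc : ∀ x, 0 ≤ x → x ≤ s → 0 ≤ (1 - 4 * x ^ 2) ^ 2 - 4 * t₁ := by
    intro x hx hxs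
    have h2 : x ^ 2 ≤ s ^ 2 := pow_le_pow_left₀ hx hxs 2
    have h3 : (1 - 4 * s ^ 2) ^ 2 ≤ (1 - 4 * x ^ 2) ^ 2 :=
      pow_le_pow_left₀ (by nlinarith) (by linarith) 2
    nlinarith [sq_nonneg (2 * s - 4 * s ^ 2)]
  -- On the arc the discriminant is the perfect square `(2s - 4s²)²`, and `areaParam` is exactly the
  -- first coordinate of the arc.
  have hsq : Real.sqrt ((1 - 4 * s ^ 2) ^ 2 - 4 * t₁) = 2 * s - 4 * s ^ 2 := by
    rw [Real.sqrt_eq_iff_mul_self_eq (hdisc s hs0 le_rfl) (by nlinarith), hst]; ring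
  have hsmall : smallRoot t₁ s = 1 / 2 - s := by unfold smallRoot; rw [hsq]; ring
  have harea : areaParam t₁ s = 4 * s ^ 3 - 6 * s ^ 4 := by
    unfold areaParam; rw [hsmall]; ring
  have harea0 : areaParam t₁ 0 = 0 := by simp [areaParam]
  have hIVT : ∀ y, 0 < y → y ≤ s → t₀ < areaParam t₁ y →
      ∃ x, 0 < x ∧ x < y ∧ p t₀ t₁ x = 0 := by
    intro y hy hys hty
    obtain ⟨x, ⟨hx0, hxy⟩, hx⟩ := intermediate_value_Ioo hy.le
      (continuous_areaParam t₁).continuousOn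
      (show t₀ ∈ Set.Ioo (areaParam t₁ 0) (areaParam t₁ y) by rw [harea0]; exact ⟨h0, hty⟩)
    exact ⟨x, hx0, hxy, p_eq_zero_of_areaParam_eq (hdisc x hx0.le (hxy.le.trans hys)) hx⟩
  obtain ⟨x₀, hx₀, hx₀s, hpx₀⟩ := hIVT s hs0' le_rfl (harea ▸ hs)
  obtain ⟨⟨hr, hpr⟩, hmin⟩ := isLeast_r h0 hx₀ hpx₀
  have hrs : r t₀ t₁ < s := (hmin ⟨hx₀, hpx₀⟩).trans_lt hx₀s
  have ha : a₀ t₀ t₁ = smallRoot t₁ (r t₀ t₁) := rfl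
  generalize r t₀ t₁ = ρ at *
  rw [ha]
  have hd := hdisc ρ hr.le hrs.le
  have hρ : ρ ^ 2 < s ^ 2 := pow_lt_pow_left₀ hrs hr.le two_ne_zero
  have hle := le_areaParam_of_root hd (by nlinarith) h1.le hpr
  -- If the area value at `ρ` exceeded `t₀`, the intermediate value theorem would give a root below
  -- the least one.
  have heq : areaParam t₁ ρ = t₀ := by
    refine le_antisymm (not_lt.1 fun hlt => ?_) hle
    obtain ⟨x, hx, hxρ, hpx⟩ := hIVT ρ hr hrs.le hlt
    exact absurd (hmin ⟨hx, hpx⟩) (not_le.2 hxρ)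
  have hadd := smallRoot_add_largeRoot t₁ ρ
  have hmul := smallRoot_mul_largeRoot hd
  have hsl := smallRoot_le_largeRoot t₁ ρ
  unfold areaParam at heq
  generalize smallRoot t₁ ρ = a at *
  generalize largeRoot t₁ ρ = b at *
  have hb : b = 1 - 4 * ρ ^ 2 - a := by linarith
  have hbpos : 0 < b := by nlinarith
  refine ⟨hr, ?_, ?_, ?_, heq.symm⟩
  · exact pos_of_mul_pos_left (hmul ▸ h1) hbpos.le
  -- The monic quadratic with roots `a ≤ b` is negative at `1/2 - s`, hence `a < 1/2 - s < 1/2 - ρ`.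
  · have : (1 / 2 - s - a) * (1 / 2 - s - b) < 0 := by
      have : (1 / 2 - s - a) * (1 / 2 - s - b) = 4 * (ρ ^ 2 - s ^ 2) * (1 / 2 - s) := by
        have e : (1 / 2 - s - a) * (1 / 2 - s - b)
          = (1 / 2 - s) ^ 2 - (1 / 2 - s) * (a + b) + a * b := by ring
        rw [e, hadd, hmul, hst]; ring
      rw [this]; nlinarith
    by_contra! hcon
    have h1 : 0 ≤ a - (1 / 2 - s) := by linarith
    have h2 : 0 ≤ b - (1 / 2 - s) := by linarith
    linarith [mul_nonneg h1 h2]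
  · subst hb; linarith

/-! ### Reflection in the unit circle -/

/-- Complex conjugation on the closed unit disc, inversion outside of it. -/
def discReflection (w : ℂ) : ℂ := if ‖w‖ ≤ 1 then conj w else w⁻¹

lemma norm_discReflection_le (w : ℂ) : ‖discReflection w‖ ≤ 1 := by
  unfold discReflection
  split_ifs with h
  · simpa using h
  · rw [norm_inv]; exact inv_le_one_of_one_le₀ (not_le.1 h).le

/-- After multiplication by `|v|²`, the difference of the squares is `(|v|² - 1)(1 + |v|² - 2 Re
(conj w * v))`, a product of nonnegative factors. -/
lemma norm_conj_sub_inv_le {w v : ℂ} (hw : ‖w‖ ≤ 1) (hv : 1 ≤ ‖v‖) :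
    ‖conj w - v⁻¹‖ ≤ ‖w - v‖ := by
  have hv0 : v ≠ 0 := norm_pos_iff.1 (by linarith)
  have h1 : ‖conj w - v⁻¹‖ * ‖v‖ = ‖conj w * v - 1‖ := by
    rw [← norm_mul, sub_mul, inv_mul_cancel₀ hv0]
  have key : ‖conj w * v - 1‖ ^ 2 ≤ (‖w - v‖ * ‖v‖) ^ 2 := by
    rw [mul_pow, Complex.sq_norm, Complex.sq_norm, Complex.sq_norm]
    have hw2 : Complex.normSq w ≤ 1 := by
      rw [← Complex.sq_norm]; nlinarith [norm_nonneg w]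
    have hv2 : 1 ≤ Complex.normSq v := by
      rw [← Complex.sq_norm]; nlinarith
    simp only [Complex.normSq_apply, Complex.sub_re, Complex.sub_im, Complex.mul_re, Complex.mul_im,
      Complex.conj_re, Complex.conj_im, Complex.one_re, Complex.one_im] at *
    have e : 2 * (w.re * v.re + w.im * v.im) ≤ 1 + (v.re * v.re + v.im * v.im) := by
      nlinarith [sq_nonneg (w.re - v.re), sq_nonneg (w.im - v.im)]
    nlinarith [mul_nonneg (sub_nonneg.2 hv2) (sub_nonneg.2 e)]
  have h3 := (le_abs_self _).trans (abs_le_of_sq_le_sq key (by positivity))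
  rw [← h1] at h3
  exact le_of_mul_le_mul_right h3 (by linarith)

lemma norm_discReflection_sub_le (w v : ℂ) :
    ‖discReflection w - discReflection v‖ ≤ ‖w - v‖ := by
  unfold discReflection
  split_ifs with hw hv hv
  · rw [← map_sub, Complex.norm_conj]
  · exact norm_conj_sub_inv_le hw (not_le.1 hv).le
  · rw [norm_sub_rev, norm_sub_rev w]
    exact norm_conj_sub_inv_le hv (not_le.1 hw).le
  · push Not at hw hv
    have hw0 : w ≠ 0 := norm_pos_iff.1 (by linarith)
    have hv0 : v ≠ 0 := norm_pos_iff.1 (by linarith)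
    rw [inv_sub_inv hw0 hv0, norm_div, norm_mul, norm_sub_rev]
    exact div_le_self (norm_nonneg _) (by nlinarith)

/-! ### The global homeomorphism that extends the rational parametrization -/

/-- The rational function `w ↦ r w + a + 2 a r / w + r² / w²`. -/
def ratMap (r a : ℝ) (w : ℂ) : ℂ := r * w + a + 2 * a * r / w + r ^ 2 / w ^ 2

/-- The harmonic extension of `ratMap` from the unit circle to the unit disc. -/
def harmMap (r a : ℝ) (w : ℂ) : ℂ := r * w + a + 2 * a * r * conj w + r ^ 2 * conj w ^ 2

def glueMap (r a : ℝ) (w : ℂ) : ℂ :=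
  a + r * (w + (2 * a * discReflection w + r * discReflection w ^ 2))

lemma glueMap_of_norm_le {r a : ℝ} {w : ℂ} (hw : ‖w‖ ≤ 1) : glueMap r a w = harmMap r a w := by
  simp only [glueMap, harmMap, discReflection, if_pos hw]; ring

lemma glueMap_of_le_norm {r a : ℝ} {w : ℂ} (hw : 1 ≤ ‖w‖) : glueMap r a w = ratMap r a w := by
  have hw0 : w ≠ 0 := norm_pos_iff.1 (by linarith)
  have : discReflection w = w⁻¹ := by
    unfold discReflection
    split_ifs with h
    · rw [Complex.inv_def, Complex.normSq_eq_norm_sq, le_antisymm h hw]; simp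
    · rfl
  simp only [glueMap, ratMap, this]; field_simp; ring

/-- The perturbation is `2aq + rq²` with `q = discReflection` bounded by 1 and 1-Lipschitz. The
constant `2a + 2r` is below 1 exactly when `a + r < 1/2`. -/
lemma approximatesLinearOn_glue {r a : ℝ} (hr : 0 < r) (ha : 0 < a) :
    ApproximatesLinearOn
      (fun w => w + (2 * a * discReflection w + r * discReflection w ^ 2))
      (ContinuousLinearEquiv.refl ℝ ℂ : ℂ →L[ℝ] ℂ) Set.univ (Real.toNNReal (2 * a + 2 * r)) := by
  intro x _ y _
  rw [Real.coe_toNNReal _ (by positivity)]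
  have e : x + (2 * a * discReflection x + r * discReflection x ^ 2) -
      (y + (2 * a * discReflection y + r * discReflection y ^ 2)) -
      (ContinuousLinearEquiv.refl ℝ ℂ : ℂ →L[ℝ] ℂ) (x - y) =
      (discReflection x - discReflection y) *
        (2 * a + r * (discReflection x + discReflection y)) := by
    simp; ring
  rw [e, norm_mul, mul_comm]
  refine mul_le_mul ?_ (norm_discReflection_sub_le x y) (norm_nonneg _) (by positivity)
  calc ‖(2 * a + r * (discReflection x + discReflection y) : ℂ)‖
      ≤ ‖(2 * a : ℂ)‖ + ‖(r * (discReflection x + discReflection y) : ℂ)‖ := norm_add_le _ _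
    _ ≤ 2 * a + r * (1 + 1) := by
      rw [norm_mul, norm_mul, Complex.norm_real, Complex.norm_real, Real.norm_of_nonneg hr.le,
        Real.norm_of_nonneg ha.le]
      have := norm_add_le_of_le (norm_discReflection_le x) (norm_discReflection_le y)
      norm_num
      gcongr
      linarith
    _ = 2 * a + 2 * r := by ring

def glueHomeo {r a : ℝ} (hr : 0 < r) (ha : 0 < a) (har : a + r < 1 / 2) : ℂ ≃ₜ ℂ :=
  (((approximatesLinearOn_glue hr ha).toHomeomorph _ (Or.inr (by
    have : (ContinuousLinearEquiv.refl ℝ ℂ).symm.toContinuousLinearMap =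
      ContinuousLinearMap.id ℝ ℂ := rfl
    rw [this, ← NNReal.coe_lt_coe, Real.coe_toNNReal _ (by positivity)]
    simp; linarith))).trans
      (Homeomorph.mulLeft₀ (r : ℂ) (by exact_mod_cast hr.ne'))).trans (Homeomorph.addLeft (a : ℂ))

lemma glueHomeo_apply {r a : ℝ} (hr : 0 < r) (ha : 0 < a) (har : a + r < 1 / 2) (w : ℂ) :
    glueHomeo hr ha har w = glueMap r a w := rfl

/-! ### The interior of the image of the unit circle under a homeomorphism -/

/-- The exterior of the disc is the image of a convex half-plane under `exp`. -/
lemma isPreconnected_one_lt_norm : IsPreconnected {w : ℂ | 1 < ‖w‖} := by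
  have h : Complex.exp '' {w : ℂ | 0 < w.re} = {w : ℂ | 1 < ‖w‖} := by
    ext w
    constructor
    · rintro ⟨v, hv, rfl⟩
      simpa [Complex.norm_exp] using hv
    · intro hw
      have hw' : 1 < ‖w‖ := hw
      have hw0 : w ≠ 0 := norm_pos_iff.1 (by linarith)
      exact ⟨Complex.log w, by simpa [Complex.log_re] using Real.log_pos hw', Complex.exp_log hw0⟩
  rw [← h]
  exact (convex_halfSpace_re_gt 0).isPreconnected.image _ Complex.continuous_exp.continuousOn

theorem interior_homeo_sphere (Φ : ℂ ≃ₜ ℂ) :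
    {z | z ∉ Φ '' Metric.sphere (0 : ℂ) 1 ∧
      Bornology.IsBounded (connectedComponentIn (Φ '' Metric.sphere (0 : ℂ) 1)ᶜ z)} =
      Φ '' Metric.ball (0 : ℂ) 1 := by
  have hcomp : ∀ w, w ∉ Metric.sphere (0 : ℂ) 1 →
      connectedComponentIn (Φ '' Metric.sphere (0 : ℂ) 1)ᶜ (Φ w) =
        Φ '' connectedComponentIn (Metric.sphere (0 : ℂ) 1)ᶜ w := by
    intro w hw
    rw [Φ.image_connectedComponentIn hw, Set.image_compl_eq Φ.bijective]
  ext z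
  obtain ⟨w, rfl⟩ := Φ.surjective z
  simp only [Set.mem_ofPred_eq, Φ.injective.mem_set_image]
  constructor
  · rintro ⟨hw, hb⟩
    rw [hcomp w hw] at hb
    by_contra hwb
    have hw1 : 1 < ‖w‖ := by
      simp only [mem_sphere_iff_norm, sub_zero, Metric.mem_ball, dist_zero_right, not_lt] at hw hwb
      exact hwb.lt_of_ne' hw
    have hsub : {w : ℂ | 1 < ‖w‖} ⊆ connectedComponentIn (Metric.sphere (0 : ℂ) 1)ᶜ w :=
      isPreconnected_one_lt_norm.subset_connectedComponentIn hw1 (by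
        intro v hv; simpa using (ne_of_gt hv))
    have hb2 := hb.subset (Set.image_mono hsub)
    -- A bounded image would have compact closure, and pulling it back by `Φ.symm` would bound the
    -- exterior of the disc.
    have hk : IsCompact (Φ.symm '' closure (Φ '' {w : ℂ | 1 < ‖w‖})) :=
      hb2.isCompact_closure.image Φ.symm.continuous
    have hb3 : Bornology.IsBounded {w : ℂ | 1 < ‖w‖} := hk.isBounded.subset fun v hv =>
      ⟨Φ v, subset_closure ⟨v, hv, rfl⟩, Φ.symm_apply_apply v⟩
    obtain ⟨R, hR⟩ := hb3.exists_norm_le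
    have := hR ((|R| + 2 : ℝ) : ℂ) (by
      simp only [Set.mem_ofPred_eq, Complex.norm_real, Real.norm_eq_abs]
      rw [abs_of_pos (by positivity)]; linarith [abs_nonneg R])
    rw [Complex.norm_real, Real.norm_eq_abs, abs_of_pos (by positivity)] at this
    linarith [le_abs_self R]
  · intro hw
    have hws : w ∉ Metric.sphere (0 : ℂ) 1 := by
      simp only [mem_sphere_iff_norm, sub_zero, Metric.mem_ball, dist_zero_right] at hw ⊢
      exact hw.ne
    refine ⟨hws, ?_⟩
    rw [hcomp w hws]
    have hsub : connectedComponentIn (Metric.sphere (0 : ℂ) 1)ᶜ w ⊆ Metric.ball (0 : ℂ) 1 := by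
      refine isPreconnected_connectedComponentIn.subset_left_of_subset_union Metric.isOpen_ball
        (isOpen_lt continuous_const continuous_norm : IsOpen {v : ℂ | 1 < ‖v‖}) ?_ ?_
        ⟨w, mem_connectedComponentIn hws, hw⟩
      · rw [Set.disjoint_left]
        intro v hv hv'
        simp only [Metric.mem_ball, dist_zero_right] at hv
        exact absurd hv (not_lt.2 (le_of_lt hv'))
      · intro v hv
        have := connectedComponentIn_subset _ _ hv
        simp only [Set.mem_compl_iff, mem_sphere_iff_norm, sub_zero] at this
        rcases lt_or_gt_of_ne this with h | h
        · exact Or.inl (by simpa using h)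
        · exact Or.inr h
    exact ((isCompact_closedBall (0 : ℂ) 1).image Φ.continuous).isBounded.subset
      (Set.image_mono (hsub.trans Metric.ball_subset_closedBall))

lemma boundaryCurve_eq {t₀ t₁ : ℝ} (hr : 0 < r t₀ t₁) (ha : 0 < a₀ t₀ t₁)
    (har : a₀ t₀ t₁ + r t₀ t₁ < 1 / 2) :
    boundaryCurve t₀ t₁ = glueHomeo hr ha har '' Metric.sphere (0 : ℂ) 1 := by
  refine Set.image_congr fun w hw => ?_
  rw [glueHomeo_apply, glueMap_of_le_norm (by simpa using hw.ge)]
  rfl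

theorem Ω_eq {t₀ t₁ : ℝ} (hr : 0 < r t₀ t₁) (ha : 0 < a₀ t₀ t₁)
    (har : a₀ t₀ t₁ + r t₀ t₁ < 1 / 2) :
    Ω t₀ t₁ = glueHomeo hr ha har '' Metric.ball (0 : ℂ) 1 := by
  rw [← interior_homeo_sphere, Ω, boundaryCurve_eq hr ha har]

/-! ### Integration in polar coordinates over the unit disc -/

lemma polarCoord_symm_eq (p : ℝ × ℝ) :
    Complex.polarCoord.symm p = p.1 * Complex.exp (p.2 * I) := by
  rw [Complex.polarCoord_symm_apply, Complex.exp_mul_I, Complex.ofReal_cos, Complex.ofReal_sin]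

lemma norm_polar (p : ℝ × ℝ) : ‖(p.1 * Complex.exp (p.2 * I) : ℂ)‖ = |p.1| := by
  rw [norm_mul, Complex.norm_exp_ofReal_mul_I, mul_one, Complex.norm_real, Real.norm_eq_abs]

/-- The open rectangle of polar coordinates of the unit disc. -/
def polarRect : Set (ℝ × ℝ) := Set.Ioo 0 1 ×ˢ Set.Ioo (-Real.pi) Real.pi

lemma measurableSet_polarRect : MeasurableSet polarRect := measurableSet_Ioo.prod measurableSet_Ioo

lemma polarRect_subset : polarRect ⊆ polarCoord.target :=
  Set.prod_mono (fun _ h => h.1) subset_rfl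

lemma indicator_polar {E : Type*} [Zero E] [SMulZeroClass ℝ E] (g : ℂ → E) {p : ℝ × ℝ}
    (hp : p ∈ polarCoord.target) :
    p.1 • (Metric.ball (0 : ℂ) 1).indicator g (Complex.polarCoord.symm p) =
      polarRect.indicator (fun p => p.1 • g (p.1 * Complex.exp (p.2 * I))) p := by
  rw [polarCoord_symm_eq]
  have h0 : 0 < p.1 := hp.1
  by_cases h : p ∈ polarRect
  · rw [Set.indicator_of_mem h, Set.indicator_of_mem]
    rw [mem_ball_zero_iff, norm_polar, abs_of_pos h0]
    exact h.1.2
  · rw [Set.indicator_of_notMem h, Set.indicator_of_notMem, smul_zero]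
    rw [mem_ball_zero_iff, norm_polar, abs_of_pos h0]
    exact fun h1 => h ⟨⟨h0, h1⟩, hp.2⟩

lemma setIntegral_ball_polar {E : Type*} [NormedAddCommGroup E] [NormedSpace ℝ E] (g : ℂ → E) :
    ∫ w in Metric.ball (0 : ℂ) 1, g w =
      ∫ p in polarRect, p.1 • g (p.1 * Complex.exp (p.2 * I)) := by
  rw [← integral_indicator measurableSet_ball, ← Complex.integral_comp_polarCoord_symm,
    setIntegral_congr_fun polarCoord.open_target.measurableSet
      (fun p hp => indicator_polar g hp), setIntegral_indicator measurableSet_polarRect,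
    Set.inter_eq_right.2 polarRect_subset]

lemma integrableOn_polarRect {E : Type*} [NormedAddCommGroup E] [NormedSpace ℝ E] {g : ℂ → E}
    (hm : AEStronglyMeasurable (fun p : ℝ × ℝ => p.1 • g (p.1 * Complex.exp (p.2 * I)))
      (volume.restrict polarRect))
    (hg : IntegrableOn g (Metric.ball 0 1)) :
    IntegrableOn (fun p : ℝ × ℝ => p.1 • g (p.1 * Complex.exp (p.2 * I))) polarRect := by
  refine ⟨hm, ?_⟩
  have h := hg.2
  rw [hasFiniteIntegral_iff_enorm, ← lintegral_indicator measurableSet_ball,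
    ← Complex.lintegral_comp_polarCoord_symm] at h
  rw [hasFiniteIntegral_iff_enorm]
  refine lt_of_le_of_lt ?_ h
  refine le_trans (le_of_eq ?_) (lintegral_mono_set polarRect_subset)
  refine setLIntegral_congr_fun measurableSet_polarRect fun p hp => ?_
  have h0 : 0 < p.1 := hp.1.1
  have hb : (p.1 * Complex.exp (p.2 * I) : ℂ) ∈ Metric.ball (0 : ℂ) 1 := by
    rw [mem_ball_zero_iff, norm_polar, abs_of_pos h0]; exact hp.1.2
  rw [polarCoord_symm_eq, Set.indicator_of_mem hb, enorm_smul, Real.enorm_eq_ofReal h0.le,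
    smul_eq_mul]

/-! ### Local integrability of the logarithmic kernel -/

/-- In polar coordinates the integrand is `y log y`, which is continuous at `0`. -/
lemma integrableOn_log_norm_ball (R : ℝ) :
    IntegrableOn (fun s : ℂ => Real.log ‖s‖) (Metric.ball 0 R) := by
  rw [integrableOn_fun_norm_addHaar volume (f := Real.log)]
  have : Continuous fun y : ℝ => y ^ (Module.finrank ℝ ℂ - 1) • Real.log y := by
    simpa using Real.continuous_mul_log
  exact (this.integrableOn_Icc (a := 0) (b := R)).mono_set Set.Ioo_subset_Icc_self

lemma integrableOn_log_norm_sub {B : Set ℂ} (hB : Bornology.IsBounded B) (z : ℂ) :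
    IntegrableOn (fun s : ℂ => Real.log ‖s - z‖) B := by
  obtain ⟨R, hR⟩ := hB.subset_ball z
  refine IntegrableOn.mono_set ?_ hR
  have h := (measurePreserving_sub_right (volume : Measure ℂ) z).integrableOn_comp_preimage
    (measurableEmbedding_subRight z) (f := fun s : ℂ => Real.log ‖s‖) (s := Metric.ball 0 R)
  have := h.2 (integrableOn_log_norm_ball R)
  have hpre : (fun x : ℂ => x - z) ⁻¹' Metric.ball 0 R = Metric.ball z R := by
    ext s; simp [dist_eq_norm]
  rwa [hpre] at this

/-! ### The primitive of the logarithmic kernel -/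

/-- A solution of `∂f/∂ū = log |u|`. -/
def logPrimitive (u : ℂ) : ℂ := conj u * (Real.log ‖u‖ - 1 / 2)

lemma continuous_logPrimitive : Continuous logPrimitive := by
  have h : Continuous fun u : ℂ => conj u * (Real.log ‖u‖ : ℂ) := by
    rw [continuous_iff_continuousAt]
    intro u
    by_cases hu : u = 0
    · subst hu
      have h0 : Filter.Tendsto (fun u : ℂ => |‖u‖ * Real.log ‖u‖|) (𝓝 0) (𝓝 0) := by
        have := ((Real.continuous_mul_log.comp (continuous_norm (E := ℂ))).abs).tendsto 0
        simpa using this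
      have : Filter.Tendsto (fun u : ℂ => conj u * (Real.log ‖u‖ : ℂ)) (𝓝 0) (𝓝 0) := by
        refine squeeze_zero_norm (fun u => ?_) h0
        rw [norm_mul, Complex.norm_conj, Complex.norm_real, abs_mul, abs_norm, Real.norm_eq_abs]
      simpa [ContinuousAt] using this
    · have h1 : ContinuousAt (fun u : ℂ => Real.log ‖u‖) u :=
        continuous_norm.continuousAt.log (norm_ne_zero_iff.2 hu)
      exact Complex.continuous_conj.continuousAt.mul
        (Complex.continuous_ofReal.continuousAt.comp h1)
  have : logPrimitive = fun u : ℂ => conj u * (Real.log ‖u‖ : ℂ) - conj u * (1 / 2) := by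
    ext u; simp only [logPrimitive]; ring
  rw [this]
  exact h.sub (Complex.continuous_conj.mul continuous_const)

/-- The conjugate-linear coefficient is exactly `log ‖u‖`: the `-1/2` in `logPrimitive` cancels the
contribution of differentiating the logarithm. -/
def logPrimitiveDeriv (u : ℂ) : ℂ →L[ℝ] ℂ :=
  (Real.log ‖u‖ : ℂ) • (Complex.conjCLE : ℂ →L[ℝ] ℂ) +
    (conj u ^ 2 / (2 * (‖u‖ : ℂ) ^ 2)) • ContinuousLinearMap.id ℝ ℂ

lemma logPrimitiveDeriv_apply (u v : ℂ) :
    logPrimitiveDeriv u v = Real.log ‖u‖ * conj v + conj u ^ 2 / (2 * (‖u‖ : ℂ) ^ 2) * v := by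
  simp [logPrimitiveDeriv]

lemma hasFDerivAt_logPrimitive {u : ℂ} (hu : u ≠ 0) :
    HasFDerivAt logPrimitive (logPrimitiveDeriv u) u := by
  have hn : ‖u‖ ^ 2 ≠ 0 := by positivity
  have h1 : HasFDerivAt (fun u : ℂ => Real.log (‖u‖ ^ 2)) ((‖u‖ ^ 2)⁻¹ • (2 • innerSL ℝ u)) u :=
    ((hasStrictFDerivAt_norm_sq u).hasFDerivAt).log hn
  have h2 : HasFDerivAt (fun u : ℂ => ((Real.log (‖u‖ ^ 2) : ℝ) : ℂ) / 2 - 1 / 2)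
      ((1 / 2 : ℂ) • Complex.ofRealCLM.comp ((‖u‖ ^ 2)⁻¹ • (2 • innerSL ℝ u))) u := by
    have := ((Complex.ofRealCLM.hasFDerivAt.comp u h1).const_mul (1 / 2 : ℂ)).sub_const (1 / 2 : ℂ)
    refine this.congr_of_eventuallyEq (Filter.Eventually.of_forall fun v => ?_)
    simp
  have h3 := (Complex.conjCLE.hasFDerivAt (x := u)).mul h2
  refine (h3.congr_of_eventuallyEq (Filter.Eventually.of_forall fun v => ?_)).congr_fderiv ?_
  · simp [logPrimitive, Real.log_pow]
  · ext v
    rw [logPrimitiveDeriv_apply]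
    have hin : ((inner ℝ u v : ℝ) : ℂ) = (conj u * v + u * conj v) / 2 := by
      rw [Complex.inner, Complex.re_eq_add_conj]; simp; ring
    have hnn : (‖u‖ : ℂ) ^ 2 = conj u * u := by rw [Complex.conj_mul']
    have hn' : (‖u‖ : ℂ) ^ 2 ≠ 0 := by exact_mod_cast hn
    have hc : conj u ≠ 0 := by simpa using hu
    simp only [add_apply, smul_apply,
      ContinuousLinearMap.comp_apply, innerSL_apply_apply, Complex.ofRealCLM_apply, smul_eq_mul,
      Real.log_pow, nsmul_eq_mul, Complex.ofReal_mul, hin, Complex.ofReal_inv, Complex.ofReal_pow,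
      Complex.conjCLE_apply, ContinuousLinearEquiv.coe_coe]
    push_cast
    rw [hnn]
    field_simp
    ring

/-! ### The area integral of the logarithmic kernel as a boundary integral -/

def realLinear (A B : ℂ) : ℂ →L[ℝ] ℂ :=
  A • ContinuousLinearMap.id ℝ ℂ + B • (Complex.conjCLE : ℂ →L[ℝ] ℂ)

lemma det_realLinear (A B : ℂ) :
    (realLinear A B).det = Complex.normSq A - Complex.normSq B := by
  rw [ContinuousLinearMap.det, ← LinearMap.det_toMatrix Complex.basisOneI, Matrix.det_fin_two]
  simp [LinearMap.toMatrix_apply, realLinear, Complex.normSq_apply]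
  ring

lemma hasFDerivAt_harmMap (r a : ℝ) (w : ℂ) :
    HasFDerivAt (harmMap r a) (realLinear r (2 * a * r + 2 * r ^ 2 * conj w)) w := by
  have hi := hasFDerivAt_id (𝕜 := ℝ) w
  have hc := Complex.conjCLE.hasFDerivAt (x := w)
  have := (((hi.const_mul (r : ℂ)).add_const (a : ℂ)).add (hc.const_mul (2 * a * r : ℂ))).add
    ((hc.mul hc).const_mul (r ^ 2 : ℂ))
  refine (this.congr_of_eventuallyEq (Filter.Eventually.of_forall fun v => ?_)).congr_fderiv ?_
  · simp only [harmMap, Pi.add_apply, Pi.mul_apply, id, Complex.conjCLE_apply]; ring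
  · ext v
    simp [realLinear]; ring

def harmJac (r a : ℝ) (w : ℂ) : ℝ := r ^ 2 - Complex.normSq (2 * a * r + 2 * r ^ 2 * conj w)

lemma harmJac_nonneg {r a : ℝ} (hr : 0 < r) (ha : 0 < a) (har : a + r < 1 / 2) {w : ℂ}
    (hw : ‖w‖ ≤ 1) : 0 ≤ harmJac r a w := by
  have h : ‖(2 * a * r + 2 * r ^ 2 * conj w : ℂ)‖ ≤ r := by
    calc _ ≤ ‖(2 * a * r : ℂ)‖ + ‖(2 * r ^ 2 * conj w : ℂ)‖ := norm_add_le _ _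
      _ = 2 * a * r + 2 * r ^ 2 * ‖w‖ := by
        simp [abs_of_pos hr, abs_of_pos ha]
      _ ≤ 2 * a * r + 2 * r ^ 2 * 1 := by gcongr
      _ ≤ r := by nlinarith
  rw [harmJac, ← Complex.sq_norm, sub_nonneg]
  exact pow_le_pow_left₀ (norm_nonneg _) h 2

lemma injOn_harmMap {r a : ℝ} (hr : 0 < r) (ha : 0 < a) (har : a + r < 1 / 2) :
    Set.InjOn (harmMap r a) (Metric.closedBall 0 1) := by
  intro x hx y hy hxy
  rw [mem_closedBall_zero_iff] at hx hy
  rw [← glueMap_of_norm_le hx, ← glueMap_of_norm_le hy] at hxy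
  exact (glueHomeo hr ha har).injective hxy

lemma abs_det_harmMap {r a : ℝ} (hr : 0 < r) (ha : 0 < a) (har : a + r < 1 / 2)
    {w : ℂ} (hw : w ∈ Metric.ball (0 : ℂ) 1) :
    |(realLinear r (2 * a * r + 2 * r ^ 2 * conj w)).det| = harmJac r a w := by
  rw [det_realLinear, Complex.normSq_ofReal, ← pow_two]
  exact abs_of_nonneg (harmJac_nonneg hr ha har (mem_ball_zero_iff.1 hw).le)

lemma isBounded_harmMap_image (r a : ℝ) :
    Bornology.IsBounded (harmMap r a '' Metric.ball 0 1) := by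
  have hc : Continuous (harmMap r a) :=
    continuous_iff_continuousAt.2 fun w => (hasFDerivAt_harmMap r a w).continuousAt
  exact ((isCompact_closedBall (0 : ℂ) 1).image hc).isBounded.subset
    (Set.image_mono Metric.ball_subset_closedBall)

lemma integrableOn_harmJac_log {r a : ℝ} (hr : 0 < r) (ha : 0 < a) (har : a + r < 1 / 2)
    (z : ℂ) :
    IntegrableOn (fun w => harmJac r a w * Real.log ‖harmMap r a w - z‖) (Metric.ball 0 1) := by
  have h := (integrableOn_image_iff_integrableOn_abs_det_fderiv_smul volume measurableSet_ball
    (fun w _ => (hasFDerivAt_harmMap r a w).hasFDerivWithinAt)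
    ((injOn_harmMap hr ha har).mono Metric.ball_subset_closedBall)
    (fun s => Real.log ‖s - z‖)).1
      (integrableOn_log_norm_sub (isBounded_harmMap_image r a) z)
  refine h.congr_fun (fun w hw => ?_) measurableSet_ball
  simp only [abs_det_harmMap hr ha har hw, smul_eq_mul]

lemma setIntegral_harmMap_image {r a : ℝ} (hr : 0 < r) (ha : 0 < a) (har : a + r < 1 / 2)
    (z : ℂ) :
    ∫ s in harmMap r a '' Metric.ball 0 1, Real.log ‖s - z‖ =
      ∫ w in Metric.ball 0 1, harmJac r a w * Real.log ‖harmMap r a w - z‖ := by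
  rw [integral_image_eq_integral_abs_det_fderiv_smul volume measurableSet_ball
    (fun w _ => (hasFDerivAt_harmMap r a w).hasFDerivWithinAt)
    ((injOn_harmMap hr ha har).mono Metric.ball_subset_closedBall)]
  refine setIntegral_congr_fun measurableSet_ball (fun w hw => ?_)
  simp only [abs_det_harmMap hr ha har hw, smul_eq_mul]

/-! ### Green's formula in polar coordinates -/

def expI (p : ℝ × ℝ) : ℂ := Complex.exp (p.2 * I)

def polarMap (r a : ℝ) (p : ℝ × ℝ) : ℂ :=
  r * (p.1 * expI p) + a + 2 * a * r * (p.1 * conj (expI p)) + r ^ 2 * (p.1 * conj (expI p)) ^ 2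

def polarMapRadial (r a : ℝ) (p : ℝ × ℝ) : ℂ :=
  r * expI p + 2 * a * r * conj (expI p) + 2 * r ^ 2 * p.1 * conj (expI p) ^ 2

def polarMapAngular (r a : ℝ) (p : ℝ × ℝ) : ℂ :=
  I * (r * (p.1 * expI p) - 2 * a * r * (p.1 * conj (expI p))
    - 2 * r ^ 2 * (p.1 * conj (expI p)) ^ 2)

/-- The linear map with the given partial derivatives. -/
def ofPartials (u v : ℂ) : ℝ × ℝ →L[ℝ] ℂ :=
  (ContinuousLinearMap.fst ℝ ℝ ℝ).smulRight u + (ContinuousLinearMap.snd ℝ ℝ ℝ).smulRight v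

lemma ofPartials_apply (u v : ℂ) (q : ℝ × ℝ) : ofPartials u v q = q.1 * u + q.2 * v := by
  simp [ofPartials]

lemma hasFDerivAt_expI (p : ℝ × ℝ) : HasFDerivAt expI (ofPartials 0 (I * expI p)) p := by
  have h1 : HasFDerivAt (fun q : ℝ × ℝ => (q.2 : ℂ) * I)
      ((Complex.ofRealCLM.comp (ContinuousLinearMap.snd ℝ ℝ ℝ)).smulRight I) p :=
    ((Complex.ofRealCLM.comp (ContinuousLinearMap.snd ℝ ℝ ℝ)).smulRight I).hasFDerivAt
  refine (h1.cexp).congr_fderiv ?_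
  refine ContinuousLinearMap.ext fun q => ?_
  rw [ofPartials_apply]
  simp [expI]; ring

lemma hasFDerivAt_conj_expI (p : ℝ × ℝ) :
    HasFDerivAt (fun p => conj (expI p)) (ofPartials 0 (-I * conj (expI p))) p := by
  refine (Complex.conjCLE.hasFDerivAt.comp p (hasFDerivAt_expI p)).congr_fderiv ?_
  refine ContinuousLinearMap.ext fun q => ?_
  simp [ofPartials_apply]

lemma hasFDerivAt_fst (p : ℝ × ℝ) :
    HasFDerivAt (fun p : ℝ × ℝ => (p.1 : ℂ)) (ofPartials 1 0) p := by
  refine ((Complex.ofRealCLM.comp (ContinuousLinearMap.fst ℝ ℝ ℝ)).hasFDerivAt).congr_fderiv ?_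
  refine ContinuousLinearMap.ext fun q => ?_
  simp [ofPartials_apply]

lemma hasFDerivAt_polarMap (r a : ℝ) (p : ℝ × ℝ) :
    HasFDerivAt (polarMap r a) (ofPartials (polarMapRadial r a p) (polarMapAngular r a p)) p := by
  have h1 := (hasFDerivAt_fst p).mul (hasFDerivAt_expI p)
  have h2 := (hasFDerivAt_fst p).mul (hasFDerivAt_conj_expI p)
  have := (((h1.const_mul (r : ℂ)).add_const (a : ℂ)).add (h2.const_mul (2 * a * r : ℂ))).add
    ((h2.mul h2).const_mul (r ^ 2 : ℂ))
  refine (this.congr_of_eventuallyEq (Filter.Eventually.of_forall fun v => ?_)).congr_fderiv ?_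
  · simp only [polarMap, Pi.add_apply, Pi.mul_apply]; ring
  · refine ContinuousLinearMap.ext fun q => ?_
    simp only [add_apply, smul_apply, ofPartials_apply, smul_eq_mul, polarMapRadial,
      polarMapAngular, Pi.mul_apply]
    ring

/-- The common mixed second partial of `polarMap`; its two occurrences cancel in the divergence. -/
def polarMapMixed (r a : ℝ) (p : ℝ × ℝ) : ℂ :=
  I * (r * expI p - 2 * a * r * conj (expI p) - 4 * r ^ 2 * p.1 * conj (expI p) ^ 2)

lemma hasFDerivAt_polarMapRadial (r a : ℝ) (p : ℝ × ℝ) :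
    HasFDerivAt (polarMapRadial r a)
      (ofPartials (2 * r ^ 2 * conj (expI p) ^ 2) (polarMapMixed r a p)) p := by
  have h0 := hasFDerivAt_fst p
  have h1 := hasFDerivAt_expI p
  have h2 := hasFDerivAt_conj_expI p
  have := ((h1.const_mul (r : ℂ)).add (h2.const_mul (2 * a * r : ℂ))).add
    (((h0.mul h2).mul h2).const_mul (2 * r ^ 2 : ℂ))
  refine (this.congr_of_eventuallyEq (Filter.Eventually.of_forall fun v => ?_)).congr_fderiv ?_
  · simp only [polarMapRadial, Pi.add_apply, Pi.mul_apply]; ring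
  · refine ContinuousLinearMap.ext fun q => ?_
    simp only [add_apply, smul_apply, ofPartials_apply, smul_eq_mul, polarMapMixed, Pi.mul_apply]
    ring

lemma hasFDerivAt_polarMapAngular (r a : ℝ) (p : ℝ × ℝ) :
    HasFDerivAt (polarMapAngular r a)
      (ofPartials (polarMapMixed r a p) (-(r * (p.1 * expI p) + 2 * a * r * (p.1 * conj (expI p))
        + 4 * r ^ 2 * (p.1 * conj (expI p)) ^ 2))) p := by
  have h1 := (hasFDerivAt_fst p).mul (hasFDerivAt_expI p)
  have h2 := (hasFDerivAt_fst p).mul (hasFDerivAt_conj_expI p)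
  have := (((h1.const_mul (r : ℂ)).sub (h2.const_mul (2 * a * r : ℂ))).sub
    ((h2.mul h2).const_mul (2 * r ^ 2 : ℂ))).const_mul I
  refine (this.congr_of_eventuallyEq (Filter.Eventually.of_forall fun v => ?_)).congr_fderiv ?_
  · simp only [polarMapAngular, Pi.sub_apply, Pi.mul_apply]; ring
  · refine ContinuousLinearMap.ext fun q => ?_
    simp only [add_apply, sub_apply, smul_apply, ofPartials_apply, smul_eq_mul, polarMapMixed,
      Pi.mul_apply]
    ring_nf
    simp only [Complex.I_sq]
    ring

lemma expI_mul_conj (p : ℝ × ℝ) : expI p * conj (expI p) = 1 := by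
  rw [Complex.mul_conj', expI, Complex.norm_exp_ofReal_mul_I]; simp

lemma polarMap_eq (r a : ℝ) (p : ℝ × ℝ) :
    polarMap r a p = harmMap r a (p.1 * Complex.exp (p.2 * I)) := by
  simp [polarMap, harmMap, expI]

lemma jacobian_polarMap (r a : ℝ) (p : ℝ × ℝ) :
    conj (polarMapRadial r a p) * polarMapAngular r a p -
      conj (polarMapAngular r a p) * polarMapRadial r a p =
      2 * I * (p.1 * harmJac r a (p.1 * Complex.exp (p.2 * I))) := by
  have h := expI_mul_conj p
  change _ = 2 * I * (p.1 * harmJac r a (p.1 * expI p))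
  simp only [polarMapRadial, polarMapAngular, harmJac, map_add, map_sub, map_mul, map_pow,
    Complex.conj_ofReal, Complex.conj_conj, Complex.conj_I, Complex.ofReal_sub, Complex.ofReal_pow,
    Complex.normSq_eq_conj_mul_self, map_ofNat]
  linear_combination 2 * I * p.1 * (r ^ 2 - (2 * a * r + 2 * r ^ 2 * p.1 * conj (expI p)) *
    (2 * a * r + 2 * r ^ 2 * p.1 * expI p)) * h

def polarFlux (r a : ℝ) (z : ℂ) (p : ℝ × ℝ) : ℂ := logPrimitive (polarMap r a p - z)

lemma hasFDerivAt_polarFlux (r a : ℝ) {z : ℂ} {p : ℝ × ℝ} (h : polarMap r a p ≠ z) :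
    HasFDerivAt (polarFlux r a z) ((logPrimitiveDeriv (polarMap r a p - z)).comp
      (ofPartials (polarMapRadial r a p) (polarMapAngular r a p))) p :=
  (hasFDerivAt_logPrimitive (sub_ne_zero.2 h)).comp p ((hasFDerivAt_polarMap r a p).sub_const z)

lemma continuous_polarMap (r a : ℝ) : Continuous (polarMap r a) :=
  continuous_iff_continuousAt.2 fun p => (hasFDerivAt_polarMap r a p).continuousAt

lemma continuous_polarFlux (r a : ℝ) (z : ℂ) : Continuous (polarFlux r a z) :=
  continuous_logPrimitive.comp ((continuous_polarMap r a).sub continuous_const)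

lemma polarRect_ae : (polarRect : Set (ℝ × ℝ)) =ᵐ[volume]
    Set.Icc ((0 : ℝ), -Real.pi) (1, Real.pi) := by
  rw [Set.Icc_prod_eq]
  exact Measure.set_prod_ae_eq Ioo_ae_eq_Icc Ioo_ae_eq_Icc

/-- The area integral of `log |s - z|` over the image of the disc as a boundary integral. -/
theorem setIntegral_log_eq {r a : ℝ} (hr : 0 < r) (ha : 0 < a) (har : a + r < 1 / 2) (z : ℂ) :
    2 * I * ((∫ s in harmMap r a '' Metric.ball 0 1, Real.log ‖s - z‖ : ℝ) : ℂ) =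
      ∫ θ in -Real.pi..Real.pi, polarFlux r a z (1, θ) * polarMapAngular r a (1, θ) := by
  set f : ℝ × ℝ → ℂ := fun p => polarFlux r a z p * polarMapAngular r a p with hf
  set g : ℝ × ℝ → ℂ := fun p => -(polarFlux r a z p * polarMapRadial r a p) with hg
  set L : ℝ × ℝ → ℝ × ℝ →L[ℝ] ℂ := fun p => (logPrimitiveDeriv (polarMap r a p - z)).comp
      (ofPartials (polarMapRadial r a p) (polarMapAngular r a p)) with hL
  set f' : ℝ × ℝ → ℝ × ℝ →L[ℝ] ℂ := fun p => polarFlux r a z p • (ofPartials (polarMapMixed r a p)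
      (-(r * (p.1 * expI p) + 2 * a * r * (p.1 * conj (expI p))
        + 4 * r ^ 2 * (p.1 * conj (expI p)) ^ 2))) + polarMapAngular r a p • L p with hf'
  set g' : ℝ × ℝ → ℝ × ℝ →L[ℝ] ℂ := fun p => -(polarFlux r a z p •
      (ofPartials (2 * r ^ 2 * conj (expI p) ^ 2) (polarMapMixed r a p))
        + polarMapRadial r a p • L p) with hg'
  set s : Set (ℝ × ℝ) := {p | p ∈ polarRect ∧ polarMap r a p = z} with hs
  -- Polar coordinates and `harmMap` are injective here, so the flux is singular at one point at
  -- most.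
  have hcount : s.Countable := by
    refine Set.Subsingleton.countable fun p hp q hq => ?_
    have hmem : ∀ p ∈ polarRect, (p.1 * Complex.exp (p.2 * I) : ℂ) ∈ Metric.closedBall (0 : ℂ) 1 :=
      fun p hp => by
        rw [mem_closedBall_zero_iff, norm_polar, abs_of_pos hp.1.1]; exact hp.1.2.le
    have h1 := injOn_harmMap hr ha har (hmem p hp.1) (hmem q hq.1)
      (by rw [← polarMap_eq, ← polarMap_eq, hp.2, hq.2])
    rw [← polarCoord_symm_eq, ← polarCoord_symm_eq] at h1
    exact Complex.polarCoord.symm.injOn (polarRect_subset hp.1) (polarRect_subset hq.1) h1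
  -- The mixed partials and the complex-linear part of `logPrimitiveDeriv` cancel; the
  -- conjugate-linear part leaves `log` times the Jacobian.
  have hdiv : ∀ p, f' p (1, 0) + g' p (0, 1) = 2 * I * ((p.1 • (harmJac r a
      (p.1 * Complex.exp (p.2 * I)) * Real.log ‖harmMap r a (p.1 * Complex.exp (p.2 * I)) - z‖)
        : ℝ) : ℂ) := by
    intro p
    have hj := jacobian_polarMap r a p
    simp only [hf', hg', hL, add_apply, smul_apply, neg_apply, ContinuousLinearMap.comp_apply,
      ofPartials_apply, logPrimitiveDeriv_apply, smul_eq_mul, polarMap_eq]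
    push_cast
    simp only [map_add, map_mul, map_one, map_zero]
    linear_combination
      (Real.log ‖harmMap r a (p.1 * Complex.exp (p.2 * I)) - z‖ : ℂ) * hj
  have hint : IntegrableOn (fun p : ℝ × ℝ => p.1 • (harmJac r a (p.1 * Complex.exp (p.2 * I))
      * Real.log ‖harmMap r a (p.1 * Complex.exp (p.2 * I)) - z‖)) polarRect := by
    refine integrableOn_polarRect
      (g := fun w => harmJac r a w * Real.log ‖harmMap r a w - z‖) ?_
      (integrableOn_harmJac_log hr ha har z)
    refine Measurable.aestronglyMeasurable ?_
    unfold harmJac harmMap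
    fun_prop
  have hcf : Continuous f := (continuous_polarFlux r a z).mul
    (continuous_iff_continuousAt.2 fun p => (hasFDerivAt_polarMapAngular r a p).continuousAt)
  have hcg : Continuous g := ((continuous_polarFlux r a z).mul
    (continuous_iff_continuousAt.2 fun p => (hasFDerivAt_polarMapRadial r a p).continuousAt)).neg
  have hmain := integral_divergence_prod_Icc_of_hasFDerivAt_off_countable_of_le f g f' g'
    ((0 : ℝ), -Real.pi) (1, Real.pi) ⟨zero_le_one, by simp [Real.pi_pos.le]⟩ s hcount
    hcf.continuousOn hcg.continuousOn
    (fun p hp => (hasFDerivAt_polarFlux r a fun h => hp.2 ⟨hp.1, h⟩).mul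
      (hasFDerivAt_polarMapAngular r a p) )
    (fun p hp => ((hasFDerivAt_polarFlux r a fun h => hp.2 ⟨hp.1, h⟩).mul
      (hasFDerivAt_polarMapRadial r a p)).neg)
    (by
      simp_rw [hdiv]
      rw [← integrableOn_congr_set_ae polarRect_ae]
      exact (hint.ofReal).const_mul _)
  -- Of the four edges of the rectangle, the sides `θ = ±π` cancel by periodicity and the side `ρ =
  -- 0` contributes nothing; only the unit circle remains.
  have hper : ∀ x : ℝ, g (x, Real.pi) = g (x, -Real.pi) := by
    intro x
    have : expI (x, Real.pi) = expI (x, -Real.pi) := by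
      simp [expI, Complex.exp_neg]
    simp only [hg, polarFlux, polarMap, polarMapRadial, this]
  have hzero : ∀ y : ℝ, f (0, y) = 0 := by
    intro y; simp [hf, polarMapAngular]
  simp only [hdiv, hper, hzero, sub_self, zero_add, intervalIntegral.integral_zero, sub_zero]
    at hmain
  rw [← hmain, setIntegral_congr_set polarRect_ae.symm, integral_const_mul, integral_complex_ofReal,
    ← setIntegral_ball_polar (fun w => harmJac r a w * Real.log ‖harmMap r a w - z‖),
    setIntegral_harmMap_image hr ha har]

/-! ### Fourier coefficients of `log |1 - b / w|` on the unit circle -/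

/-- The point of the unit circle with argument `θ`. -/
def circ (θ : ℝ) : ℂ := Complex.exp (θ * I)

lemma continuous_circ : Continuous circ := by unfold circ; fun_prop

lemma norm_circ (θ : ℝ) : ‖circ θ‖ = 1 := Complex.norm_exp_ofReal_mul_I θ

lemma circ_ne_zero (θ : ℝ) : circ θ ≠ 0 := Complex.exp_ne_zero _

lemma conj_circ (θ : ℝ) : conj (circ θ) = (circ θ)⁻¹ := by
  rw [Complex.inv_def, Complex.normSq_eq_norm_sq, norm_circ]; simp

lemma integral_circ_zpow (n : ℤ) :
    ∫ θ in -Real.pi..Real.pi, circ θ ^ n = if n = 0 then 2 * (Real.pi : ℂ) else 0 := by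
  split_ifs with h
  · subst h; simp; ring
  · have hc : (n * I : ℂ) ≠ 0 := mul_ne_zero (by exact_mod_cast h) Complex.I_ne_zero
    have h1 : ∀ θ : ℝ, circ θ ^ n = Complex.exp (n * I * θ) := fun θ => by
      rw [circ, ← Complex.exp_int_mul]; ring_nf
    simp_rw [h1]
    rw [integral_exp_mul_complex hc]
    have h2 : Complex.exp (n * I * (Real.pi : ℝ)) = Complex.exp (n * I * ((-Real.pi : ℝ) : ℂ)) := by
      rw [Complex.exp_eq_exp_iff_exists_int]
      exact ⟨n, by push_cast; ring⟩
    rw [h2, sub_self, zero_div]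

/-- The real part of the Taylor series of `-log (1 - x)`; the term `k = 0` vanishes because division
by zero gives zero. -/
lemma hasSum_log_norm {x : ℂ} (hx : ‖x‖ < 1) :
    HasSum (fun k : ℕ => (x ^ k + conj x ^ k) / (2 * k)) (-(Real.log ‖1 - x‖ : ℂ)) := by
  have h1 := Complex.hasSum_re (Complex.hasSum_taylorSeries_neg_log hx)
  have h2 := Complex.hasSum_ofReal.2 h1
  have e : ((-(Complex.log (1 - x))).re : ℂ) = -(Real.log ‖1 - x‖ : ℂ) := by
    rw [Complex.neg_re, Complex.log_re]; push_cast; rfl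
  rw [e] at h2
  refine h2.congr_fun ?_
  intro k
  rw [Complex.re_eq_add_conj]
  simp only [map_div₀, map_pow, map_natCast]
  ring

lemma norm_log_term_le {x : ℂ} (k : ℕ) :
    ‖(x ^ k + conj x ^ k) / (2 * k : ℂ)‖ ≤ ‖x‖ ^ k := by
  rcases Nat.eq_zero_or_pos k with rfl | hk
  · simp
  · rw [norm_div, div_le_iff₀ (by simpa using hk)]
    have h1 : ‖x ^ k + conj x ^ k‖ ≤ ‖x‖ ^ k + ‖x‖ ^ k := by
      refine (norm_add_le _ _).trans ?_
      simp
    have h2 : (1 : ℝ) ≤ k := by exact_mod_cast hk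
    have h3 : ‖(2 * k : ℂ)‖ = 2 * k := by simp
    rw [h3]
    nlinarith [pow_nonneg (norm_nonneg x) k]

lemma continuous_log_norm_one_sub {b : ℂ} (hb : ‖b‖ < 1) :
    Continuous fun θ : ℝ => Real.log ‖1 - b * (circ θ)⁻¹‖ := by
  refine Continuous.log ?_ fun θ h => ?_
  · exact (continuous_const.sub (continuous_const.mul
      (continuous_circ.inv₀ circ_ne_zero))).norm
  · rw [norm_eq_zero, sub_eq_zero] at h
    have := congrArg norm h
    rw [norm_mul, norm_inv, norm_circ, norm_one] at this
    linarith

lemma integral_circ_pow_mul_log {b : ℂ} (hb : ‖b‖ < 1) (N : ℕ) :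
    ∫ θ in -Real.pi..Real.pi, circ θ ^ N * (Real.log ‖1 - b * (circ θ)⁻¹‖ : ℂ) =
      -(Real.pi * (b ^ N / N)) := by
  have hx : ∀ θ, ‖b * (circ θ)⁻¹‖ = ‖b‖ := fun θ => by rw [norm_mul, norm_inv, norm_circ]; simp
  set F : ℕ → ℝ → ℂ := fun k θ =>
    circ θ ^ N * (((b * (circ θ)⁻¹) ^ k + conj (b * (circ θ)⁻¹) ^ k) / (2 * k)) with hF
  have hFe : ∀ k θ, F k θ = b ^ k / (2 * k) * circ θ ^ ((N : ℤ) - k) +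
      conj b ^ k / (2 * k) * circ θ ^ ((N : ℤ) + k) := by
    intro k θ
    have := circ_ne_zero θ
    simp only [hF, map_mul, map_inv₀, conj_circ, inv_inv, mul_pow, inv_pow]
    rw [zpow_sub₀ this, zpow_add₀ this, zpow_natCast, zpow_natCast]
    field_simp
  have hcont : ∀ k, Continuous (F k) := fun k => by
    have h2 := continuous_circ.inv₀ circ_ne_zero
    have h1 := continuous_circ
    have h3 := Complex.continuous_conj
    simp only [hF]
    exact (h1.pow N).mul ((((continuous_const.mul h2).pow k).add
      ((h3.comp (continuous_const.mul h2)).pow k)).div_const _)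
  -- By orthogonality only frequency zero survives, that is `k = N`; for `N = 0` both sides vanish
  -- through division by zero.
  have hint : ∀ k, ∫ θ in -Real.pi..Real.pi, F k θ = if k = N then Real.pi * (b ^ N / N) else 0 := by
    intro k
    have hi : ∀ n : ℤ, Continuous fun θ => circ θ ^ n := fun n =>
      continuous_circ.zpow₀ n fun θ => Or.inl (circ_ne_zero θ)
    have hi' : ∀ (c : ℂ) (n : ℤ), IntervalIntegrable (fun θ => c * circ θ ^ n) volume
        (-Real.pi) Real.pi := fun c n => (continuous_const.mul (hi n)).intervalIntegrable _ _
    simp_rw [hFe]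
    rw [intervalIntegral.integral_add (hi' _ _) (hi' _ _),
      intervalIntegral.integral_const_mul, intervalIntegral.integral_const_mul,
      integral_circ_zpow, integral_circ_zpow]
    rcases Nat.eq_zero_or_pos k with rfl | hk
    · by_cases h : 0 = N
      · subst h; simp
      · simp [h]
    · have h1 : (N : ℤ) + k ≠ 0 := by omega
      rw [if_neg h1]
      by_cases h : k = N
      · subst h
        have : (k : ℂ) ≠ 0 := by exact_mod_cast hk.ne'
        simp; field_simp
      · rw [if_neg (by omega), if_neg h]; simp
  have hsum : HasSum (fun k => ∫ θ in -Real.pi..Real.pi, F k θ)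
      (∫ θ in -Real.pi..Real.pi, -(circ θ ^ N * (Real.log ‖1 - b * (circ θ)⁻¹‖ : ℂ))) := by
    refine intervalIntegral.hasSum_integral_of_dominated_convergence (fun k _ => ‖b‖ ^ k)
      (fun k => (hcont k).aestronglyMeasurable) ?_ ?_ ?_ ?_
    · intro k
      refine Filter.Eventually.of_forall fun θ _ => ?_
      rw [hF, norm_mul, norm_pow, norm_circ, one_pow, one_mul]
      exact (norm_log_term_le k).trans (by rw [hx])
    · exact Filter.Eventually.of_forall fun θ _ => summable_geometric_of_lt_one (norm_nonneg b) hb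
    · exact intervalIntegrable_const
    · refine Filter.Eventually.of_forall fun θ _ => ?_
      have := (hasSum_log_norm (x := b * (circ θ)⁻¹) (by rw [hx]; exact hb)).mul_left (circ θ ^ N)
      rwa [mul_neg] at this
  simp_rw [hint] at hsum
  have := hsum.unique (hasSum_ite_eq N _)
  rw [intervalIntegral.integral_neg] at this
  rw [← this, neg_neg]

/-- Fourier coefficients of `C + ∑ log |1 - b / w|`. -/
lemma integral_circ_pow_mul_sum {b₁ b₂ b₃ : ℂ} (h₁ : ‖b₁‖ < 1) (h₂ : ‖b₂‖ < 1) (h₃ : ‖b₃‖ < 1)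
    {C : ℝ} {f : ℝ → ℝ} (hf : ∀ θ, f θ = C + (Real.log ‖1 - b₁ * (circ θ)⁻¹‖ +
      Real.log ‖1 - b₂ * (circ θ)⁻¹‖ + Real.log ‖1 - b₃ * (circ θ)⁻¹‖)) (N : ℕ) :
    ∫ θ in -Real.pi..Real.pi, circ θ ^ N * (f θ : ℂ) =
      (if N = 0 then 2 * (Real.pi : ℂ) * C else 0) -
        Real.pi * ((b₁ ^ N + b₂ ^ N + b₃ ^ N) / N) := by
  have hc : ∀ {b : ℂ}, ‖b‖ < 1 → IntervalIntegrable
      (fun θ => circ θ ^ N * (Real.log ‖1 - b * (circ θ)⁻¹‖ : ℂ)) volume (-Real.pi) Real.pi :=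
    fun hb => ((continuous_circ.pow N).mul (Complex.continuous_ofReal.comp
      (continuous_log_norm_one_sub hb))).intervalIntegrable _ _
  have hC : IntervalIntegrable (fun θ => circ θ ^ (N : ℤ) * (C : ℂ)) volume
      (-Real.pi) Real.pi := by
    simp only [zpow_natCast]
    exact ((continuous_circ.pow N).mul continuous_const).intervalIntegrable _ _
  have e : ∀ θ, circ θ ^ N * (f θ : ℂ) = circ θ ^ (N : ℤ) * C +
      (circ θ ^ N * (Real.log ‖1 - b₁ * (circ θ)⁻¹‖ : ℂ) +
        circ θ ^ N * (Real.log ‖1 - b₂ * (circ θ)⁻¹‖ : ℂ) +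
          circ θ ^ N * (Real.log ‖1 - b₃ * (circ θ)⁻¹‖ : ℂ)) := by
    intro θ; rw [hf, zpow_natCast]; push_cast; ring
  simp_rw [e]
  rw [intervalIntegral.integral_add hC (((hc h₁).add (hc h₂)).add (hc h₃)),
    intervalIntegral.integral_add ((hc h₁).add (hc h₂)) (hc h₃),
    intervalIntegral.integral_add (hc h₁) (hc h₂), intervalIntegral.integral_mul_const,
    integral_circ_zpow, integral_circ_pow_mul_log h₁, integral_circ_pow_mul_log h₂,
    integral_circ_pow_mul_log h₃]
  simp only [Nat.cast_eq_zero]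
  split_ifs <;> ring

lemma integral_circ_inv_pow_mul (f : ℝ → ℝ) (N : ℕ) :
    ∫ θ in -Real.pi..Real.pi, (circ θ)⁻¹ ^ N * (f θ : ℂ) =
      conj (∫ θ in -Real.pi..Real.pi, circ θ ^ N * (f θ : ℂ)) := by
  rw [intervalIntegral.integral_of_le (by linarith [Real.pi_pos]),
    intervalIntegral.integral_of_le (by linarith [Real.pi_pos]), ← integral_conj]
  simp only [map_mul, map_pow, conj_circ, Complex.conj_ofReal]

/-- Evaluation of the boundary integral from a factorization of `h(w) - z` on the circle. -/
theorem setIntegral_log_eq_of_factorization {r a : ℝ} (hr : 0 < r) (ha : 0 < a)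
    (har : a + r < 1 / 2) (z : ℂ) {b₁ b₂ b₃ : ℂ} (h₁ : ‖b₁‖ < 1) (h₂ : ‖b₂‖ < 1) (h₃ : ‖b₃‖ < 1)
    {C : ℝ} (hf : ∀ θ, Real.log ‖polarMap r a (1, θ) - z‖ =
      C + (Real.log ‖1 - b₁ * (circ θ)⁻¹‖ + Real.log ‖1 - b₂ * (circ θ)⁻¹‖ +
        Real.log ‖1 - b₃ * (circ θ)⁻¹‖)) {p₁ p₂ p₃ : ℂ} (hp₁ : p₁ = b₁ + b₂ + b₃)
    (hp₂ : p₂ = b₁ ^ 2 + b₂ ^ 2 + b₃ ^ 2) (hp₃ : p₃ = b₁ ^ 3 + b₂ ^ 3 + b₃ ^ 3) :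
    2 * ((∫ s in harmMap r a '' Metric.ball 0 1, Real.log ‖s - z‖ : ℝ) : ℂ) =
      Real.pi * (r ^ 2 * (1 - 2 * r ^ 2 - 4 * a ^ 2) * (2 * C - 1)
        - (((a - conj z) * r - 2 * a * r ^ 3) * p₁
          + (-2 * a * r * (a - conj z) - 4 * a * r ^ 3) * conj p₁
          + 2 * a * r ^ 2 * p₂ / 2 + (-2 * a * r ^ 2 - 2 * r ^ 2 * (a - conj z)) * conj p₂ / 2
          + r ^ 3 * p₃ / 3 + (-2 * r ^ 3) * conj p₃ / 3)) := by
  set f : ℝ → ℝ := fun θ => Real.log ‖polarMap r a (1, θ) - z‖ - 1 / 2 with hfdef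
  have hf' : ∀ θ, f θ = (C - 1 / 2) + (Real.log ‖1 - b₁ * (circ θ)⁻¹‖ +
      Real.log ‖1 - b₂ * (circ θ)⁻¹‖ + Real.log ‖1 - b₃ * (circ θ)⁻¹‖) := by
    intro θ; rw [hfdef]; simp only; rw [hf]; ring
  have hfc : Continuous f := by
    have : f = fun θ => (C - 1 / 2) + (Real.log ‖1 - b₁ * (circ θ)⁻¹‖ +
      Real.log ‖1 - b₂ * (circ θ)⁻¹‖ + Real.log ‖1 - b₃ * (circ θ)⁻¹‖) := funext hf'
    rw [this]
    exact continuous_const.add (((continuous_log_norm_one_sub h₁).add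
      (continuous_log_norm_one_sub h₂)).add (continuous_log_norm_one_sub h₃))
  have hfc' := Complex.continuous_ofReal.comp hfc
  have hP : ∀ N : ℕ, IntervalIntegrable (fun θ => circ θ ^ N * (f θ : ℂ)) volume
      (-Real.pi) Real.pi := fun N =>
    ((continuous_circ.pow N).mul hfc').intervalIntegrable _ _
  have hM : ∀ N : ℕ, IntervalIntegrable (fun θ => (circ θ)⁻¹ ^ N * (f θ : ℂ)) volume
      (-Real.pi) Real.pi := fun N =>
    (((continuous_circ.inv₀ circ_ne_zero).pow N).mul hfc').intervalIntegrable _ _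
  have hIP := integral_circ_pow_mul_sum h₁ h₂ h₃ hf'
  have hIM : ∀ N, _ := fun N => (integral_circ_inv_pow_mul f N).trans (congrArg conj (hIP N))
  have hmain := setIntegral_log_eq hr ha har z
  -- Since `conj w = 1/w` on the circle, `conj (h - z) ∂h/∂θ` is `I` times a Laurent polynomial with
  -- exponents from `-3` to `3`.
  have e : ∀ θ, polarFlux r a z (1, θ) * polarMapAngular r a (1, θ) = I * (
      (r ^ 2 * (1 - 2 * r ^ 2 - 4 * a ^ 2)) * (circ θ ^ 0 * (f θ : ℂ))
      + ((a - conj z) * r - 2 * a * r ^ 3) * (circ θ ^ 1 * (f θ : ℂ))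
      + (-2 * a * r * (a - conj z) - 4 * a * r ^ 3) * ((circ θ)⁻¹ ^ 1 * (f θ : ℂ))
      + 2 * a * r ^ 2 * (circ θ ^ 2 * (f θ : ℂ))
      + (-2 * a * r ^ 2 - 2 * r ^ 2 * (a - conj z)) * ((circ θ)⁻¹ ^ 2 * (f θ : ℂ))
      + r ^ 3 * (circ θ ^ 3 * (f θ : ℂ)) + (-2 * r ^ 3) * ((circ θ)⁻¹ ^ 3 * (f θ : ℂ))) := by
    intro θ
    have hl : polarFlux r a z (1, θ) = conj (polarMap r a (1, θ) - z) * (f θ : ℂ) := by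
      simp only [polarFlux, logPrimitive, hfdef]; push_cast; ring
    rw [hl]
    have hE : expI (1, θ) = circ θ := rfl
    simp only [polarMap, polarMapAngular, hE, conj_circ, map_sub, map_add, map_mul, map_pow,
      map_inv₀, Complex.conj_ofReal, inv_inv, Complex.ofReal_one, map_ofNat, map_one]
    have := circ_ne_zero θ
    field_simp
    ring
  simp_rw [e] at hmain
  rw [intervalIntegral.integral_const_mul] at hmain
  have cP := fun c N => (hP N).const_mul c
  have cM := fun c N => (hM N).const_mul c
  have s1 := (cP (r ^ 2 * (1 - 2 * r ^ 2 - 4 * a ^ 2)) 0).add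
    (cP ((a - conj z) * r - 2 * a * r ^ 3) 1)
  have s2 := s1.add (cM (-2 * a * r * (a - conj z) - 4 * a * r ^ 3) 1)
  have s3 := s2.add (cP (2 * a * r ^ 2) 2)
  have s4 := s3.add (cM (-2 * a * r ^ 2 - 2 * r ^ 2 * (a - conj z)) 2)
  have s5 := s4.add (cP (r ^ 3) 3)
  rw [intervalIntegral.integral_add s5 (cM _ 3), intervalIntegral.integral_add s4 (cP _ 3),
    intervalIntegral.integral_add s3 (cM _ 2), intervalIntegral.integral_add s2 (cP _ 2),
    intervalIntegral.integral_add s1 (cM _ 1), intervalIntegral.integral_add (cP _ 0) (cP _ 1)]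
    at hmain
  simp only [intervalIntegral.integral_const_mul, hIP, hIM] at hmain
  have hI := Complex.I_ne_zero
  rw [mul_comm 2 I, mul_assoc] at hmain
  rw [mul_left_cancel₀ hI hmain, hp₁, hp₂, hp₃]
  simp [map_ofNat]
  ring

/-! ### The fibres of the rational parametrization -/

lemma polarMap_one (r a θ : ℝ) : polarMap r a (1, θ) = ratMap r a (circ θ) := by
  have hE : expI (1, θ) = circ θ := rfl
  simp only [polarMap, ratMap, hE, conj_circ, Complex.ofReal_one]
  ring

lemma exists_ratMap_eq {r : ℝ} (hr : 0 < r) (a : ℝ) (z : ℂ) : ∃ w ≠ 0, ratMap r a w = z := by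
  have hr' : (r : ℂ) ≠ 0 := by exact_mod_cast hr.ne'
  obtain ⟨w, hw⟩ := IsAlgClosed.exists_root
    (Polynomial.C (r : ℂ) * Polynomial.X ^ 3 + Polynomial.C (a - z : ℂ) * Polynomial.X ^ 2 +
      Polynomial.C (2 * a * r : ℂ) * Polynomial.X + Polynomial.C (r ^ 2 : ℂ))
    (by rw [Polynomial.degree_cubic hr']; norm_num)
  simp only [Polynomial.IsRoot, Polynomial.eval_add, Polynomial.eval_mul, Polynomial.eval_C,
    Polynomial.eval_pow, Polynomial.eval_X] at hw
  have hw0 : w ≠ 0 := by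
    rintro rfl
    simp [hr'] at hw
  refine ⟨w, hw0, ?_⟩
  unfold ratMap
  field_simp
  linear_combination hw

lemma exists_sum_prod (S P : ℂ) : ∃ x y : ℂ, x + y = S ∧ x * y = P := by
  obtain ⟨s, hs⟩ := IsAlgClosed.exists_pow_nat_eq (S ^ 2 - 4 * P) two_pos
  exact ⟨(S + s) / 2, (S - s) / 2, by ring, by linear_combination (-1 / 4) * hs⟩

/-- The hypotheses are Vieta's relations for the cubic `w² (h(w) - h(ζ))` with the root `ζ` split
off; `x` and `y` are the other roots, with multiplicity. -/
lemma ratMap_sub_eq {r a : ℝ} {ζ x y w : ℂ} (hζ : ζ ≠ 0) (hw : w ≠ 0)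
    (hs : x + y = 2 * a / ζ + r / ζ ^ 2) (hp : x * y = -(r / ζ)) :
    ratMap r a w - ratMap r a ζ = r * w * ((1 - ζ * w⁻¹) * (1 - x * w⁻¹) * (1 - y * w⁻¹)) := by
  have hy : y = 2 * a / ζ + r / ζ ^ 2 - x := by linear_combination hs
  have e : (1 - x * w⁻¹) * (1 - y * w⁻¹) =
      1 - (2 * a / ζ + r / ζ ^ 2) * w⁻¹ + (-(r / ζ)) * w⁻¹ ^ 2 := by
    rw [← hs, ← hp]; ring
  rw [mul_assoc (1 - ζ * w⁻¹), e]
  unfold ratMap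
  field_simp
  ring

/-- If `‖x‖ ≥ 1`, the quadratic equation of `x` gives `‖x‖² ≤ (2a + r)‖x‖ + r ≤ (2a + 2r)‖x‖ < ‖x‖`.
-/
lemma norm_lt_one_of_sum_prod {r a : ℝ} (hr : 0 < r) (ha : 0 < a) (har : a + r < 1 / 2)
    {ζ x y : ℂ} (hζ : 1 ≤ ‖ζ‖) (hs : x + y = 2 * a / ζ + r / ζ ^ 2) (hp : x * y = -(r / ζ)) :
    ‖x‖ < 1 := by
  by_contra! hx
  have hS : ‖(2 * a / ζ + r / ζ ^ 2 : ℂ)‖ ≤ 2 * a + r := by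
    refine (norm_add_le _ _).trans (add_le_add ?_ ?_)
    · rw [norm_div]
      refine (div_le_self (norm_nonneg _) hζ).trans ?_
      simp [abs_of_pos ha]
    · rw [norm_div, norm_pow]
      refine (div_le_self (norm_nonneg _) (one_le_pow₀ hζ)).trans ?_
      simp [abs_of_pos hr]
  have hP : ‖(-(r / ζ) : ℂ)‖ ≤ r := by
    rw [norm_neg, norm_div]
    refine (div_le_self (norm_nonneg _) hζ).trans ?_
    simp [abs_of_pos hr]
  have hxx : x ^ 2 = (2 * a / ζ + r / ζ ^ 2) * x - (-(r / ζ)) := by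
    rw [← hs, ← hp]; ring
  have h1 : ‖x‖ ^ 2 ≤ (2 * a + r) * ‖x‖ + r := by
    rw [← norm_pow, hxx]
    refine (norm_sub_le _ _).trans (add_le_add ?_ hP)
    rw [norm_mul]
    gcongr
  nlinarith

lemma log_norm_ratMap_sub {r a : ℝ} (hr : 0 < r) {ζ x y : ℂ} (hζ : ζ ≠ 0)
    (hζ1 : ‖ζ‖ ≠ 1) (hx : ‖x‖ < 1) (hy : ‖y‖ < 1)
    (hs : x + y = 2 * a / ζ + r / ζ ^ 2) (hp : x * y = -(r / ζ)) (θ : ℝ) :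
    Real.log ‖polarMap r a (1, θ) - ratMap r a ζ‖ =
      Real.log r + (Real.log ‖1 - ζ * (circ θ)⁻¹‖ + Real.log ‖1 - x * (circ θ)⁻¹‖ +
        Real.log ‖1 - y * (circ θ)⁻¹‖) := by
  have hne : ∀ b : ℂ, ‖b‖ ≠ 1 → ‖1 - b * (circ θ)⁻¹‖ ≠ 0 := by
    intro b hb h
    rw [norm_eq_zero, sub_eq_zero] at h
    have := congrArg norm h
    rw [norm_mul, norm_inv, norm_circ, norm_one, inv_one, mul_one] at this
    exact hb this.symm
  have h1 := hne ζ hζ1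
  have h2 := hne x hx.ne
  have h3 := hne y hy.ne
  rw [polarMap_one, ratMap_sub_eq hζ (circ_ne_zero θ) hs hp, norm_mul, norm_mul, norm_mul, norm_mul,
    norm_circ, mul_one, Complex.norm_real, Real.norm_of_nonneg hr.le,
    Real.log_mul hr.ne' (mul_ne_zero (mul_ne_zero h1 h2) h3), Real.log_mul (mul_ne_zero h1 h2) h3,
    Real.log_mul h1 h2]

/-- On the circle `1 - ζ/w` equals `-ζ/w` times the conjugate of `1 - 1/(conj ζ * w)`. This moves an
exterior root into the disc at the cost of `log ‖ζ‖`. -/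
lemma log_norm_one_sub_reflect {ζ : ℂ} (hζ : ζ ≠ 0) (hζ1 : ‖ζ‖ ≠ 1) (θ : ℝ) :
    Real.log ‖1 - ζ * (circ θ)⁻¹‖ =
      Real.log ‖ζ‖ + Real.log ‖1 - (conj ζ)⁻¹ * (circ θ)⁻¹‖ := by
  have hc : conj ζ ≠ 0 := by simpa using hζ
  have e : 1 - ζ * (circ θ)⁻¹ = -(ζ * (circ θ)⁻¹ * conj (1 - (conj ζ)⁻¹ * (circ θ)⁻¹)) := by
    have := circ_ne_zero θ
    simp only [map_sub, map_one, map_mul, map_inv₀, Complex.conj_conj, conj_circ, inv_inv]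
    field_simp
    ring
  have hne : ‖1 - (conj ζ)⁻¹ * (circ θ)⁻¹‖ ≠ 0 := by
    intro h
    rw [norm_eq_zero, sub_eq_zero] at h
    have := congrArg norm h
    rw [norm_mul, norm_inv, norm_inv, norm_circ, norm_one, inv_one, mul_one,
      Complex.norm_conj] at this
    exact hζ1 (inv_eq_one.1 this.symm)
  rw [e, norm_neg, norm_mul, norm_mul, norm_inv, norm_circ, Complex.norm_conj, inv_one, mul_one,
    Real.log_mul (norm_ne_zero_iff.2 hζ) hne]

/-! ### The total potential inside and outside of the droplet -/

/-- `t₀` times the total potential of the normalized area measure. -/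
def scaledEnergy (r a t₁ : ℝ) (z : ℂ) : ℝ :=
  -(2 / Real.pi) * (∫ s in harmMap r a '' Metric.ball 0 1, Real.log ‖s - z‖) +
    (‖z‖ ^ 2 - 2 * (V t₁ z).re)

def equilibriumConstant (r a t₁ : ℝ) : ℝ :=
  r ^ 2 * (1 - 2 * r ^ 2 - 4 * a ^ 2) * (1 - 2 * Real.log r) + r ^ 4 + a ^ 2 - 2 * a ^ 3 / 3
    - 2 * t₁ * a

/-- The boundary integral has a jointly continuous integrand, unlike the area integral with its
logarithmic singularity. -/
lemma continuous_scaledEnergy {r a : ℝ} (hr : 0 < r) (ha : 0 < a) (har : a + r < 1 / 2) (t₁ : ℝ) :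
    Continuous (scaledEnergy r a t₁) := by
  have hA : Continuous (polarMapAngular r a) :=
    continuous_iff_continuousAt.2 fun p => (hasFDerivAt_polarMapAngular r a p).continuousAt
  have h1 : Continuous fun z : ℂ =>
      ∫ θ in -Real.pi..Real.pi, polarFlux r a z (1, θ) * polarMapAngular r a (1, θ) := by
    refine intervalIntegral.continuous_parametric_intervalIntegral_of_continuous' ?_ _ _
    have hP := continuous_polarMap r a
    have hL := continuous_logPrimitive
    simp only [Function.uncurry_def, polarFlux]
    fun_prop
  have h2 : Continuous fun z : ℂ => ∫ s in harmMap r a '' Metric.ball 0 1, Real.log ‖s - z‖ := by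
    have e : (fun z : ℂ => ∫ s in harmMap r a '' Metric.ball 0 1, Real.log ‖s - z‖) = fun z =>
        ((2 * I)⁻¹ * ∫ θ in -Real.pi..Real.pi,
          polarFlux r a z (1, θ) * polarMapAngular r a (1, θ)).re := by
      ext z
      rw [← setIntegral_log_eq hr ha har, inv_mul_cancel_left₀ (by simp), Complex.ofReal_re]
    rw [e]
    exact Complex.continuous_re.comp (continuous_const.mul h1)
  unfold scaledEnergy V
  fun_prop

lemma scaledEnergy_cast (r a t₁ : ℝ) (z : ℂ) {X : ℂ}
    (hX : 2 * ((∫ s in harmMap r a '' Metric.ball 0 1, Real.log ‖s - z‖ : ℝ) : ℂ)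
      = Real.pi * X) :
    (scaledEnergy r a t₁ z : ℂ) = -X + (z * conj z - V t₁ z - V t₁ (conj z)) := by
  have hπ : (Real.pi : ℂ) ≠ 0 := by exact_mod_cast Real.pi_ne_zero
  have hV : ((V t₁ z).re : ℂ) = (V t₁ z + V t₁ (conj z)) / 2 := by
    rw [Complex.re_eq_add_conj]; simp [V, map_ofNat]
  have hX' : X = 2 / Real.pi *
      ((∫ s in harmMap r a '' Metric.ball 0 1, Real.log ‖s - z‖ : ℝ) : ℂ) := by
    field_simp; linear_combination -hX
  rw [scaledEnergy, hX', Complex.mul_conj']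
  push_cast [hV]
  ring

/-- Newton's identities with elementary symmetric functions `(z - a)/r`, `2a` and `-r`. -/
lemma powerSums {r a : ℝ} (hr : 0 < r) {z ζ x y : ℂ} (hζ : ζ ≠ 0)
    (hz : ratMap r a ζ = z) (hs : x + y = 2 * a / ζ + r / ζ ^ 2) (hp : x * y = -(r / ζ)) :
    ζ + x + y = (z - a) / r ∧ ζ ^ 2 + x ^ 2 + y ^ 2 = ((z - a) / r) ^ 2 - 4 * a ∧
      ζ ^ 3 + x ^ 3 + y ^ 3 = ((z - a) / r) ^ 3 - 6 * a * ((z - a) / r) - 3 * r := by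
  have hr' : (r : ℂ) ≠ 0 := by exact_mod_cast hr.ne'
  have e1 : ζ + x + y = (z - a) / r := by
    rw [add_assoc, hs, ← hz, ratMap]; field_simp; ring
  have e2 : ζ * (x + y) + x * y = 2 * a := by rw [hs, hp]; field_simp; ring
  have e3 : ζ * (x * y) = -r := by rw [hp]; field_simp
  refine ⟨e1, ?_, ?_⟩
  · rw [← e1]; linear_combination (-2) * e2
  · rw [← e1]; linear_combination (-3) * (ζ + x + y) * e2 + 3 * e3

theorem scaledEnergy_of_mem {r a t₁ : ℝ} (hr : 0 < r) (ha : 0 < a) (har : a + r < 1 / 2)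
    (ht₁ : t₁ = a - a ^ 2 - 4 * a * r ^ 2) {z : ℂ}
    (hz : z ∈ harmMap r a '' Metric.ball 0 1) :
    scaledEnergy r a t₁ z = equilibriumConstant r a t₁ := by
  have hr' : (r : ℂ) ≠ 0 := by exact_mod_cast hr.ne'
  -- A solution outside the open disc would share its value under the injective glued map with the
  -- given point of the disc.
  have hin : ∀ w, ratMap r a w = z → ‖w‖ < 1 := by
    intro w hw
    by_contra! h
    obtain ⟨v, hv, hvz⟩ := hz
    rw [mem_ball_zero_iff] at hv
    have : glueHomeo hr ha har w = glueHomeo hr ha har v := by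
      rw [glueHomeo_apply, glueHomeo_apply, glueMap_of_le_norm h, glueMap_of_norm_le hv.le, hw, hvz]
    have := (glueHomeo hr ha har).injective this
    subst this
    linarith
  obtain ⟨ζ, hζ, hζz⟩ := exists_ratMap_eq hr a z
  obtain ⟨x, y, hs, hp⟩ := exists_sum_prod (2 * a / ζ + r / ζ ^ 2) (-(r / ζ))
  have hxy : x * y ≠ 0 := by rw [hp]; simp [hr', hζ]
  have hx0 := left_ne_zero_of_mul hxy
  have hy0 := right_ne_zero_of_mul hxy
  have hroot : ∀ w, w ≠ 0 → w = x ∨ w = y → ratMap r a w = z := by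
    intro w hw hwxy
    have := ratMap_sub_eq hζ hw hs hp
    rw [← hζz, ← sub_eq_zero, this]
    rcases hwxy with rfl | rfl <;> simp [hw]
  have hζ1 := hin ζ hζz
  have hx1 := hin x (hroot x hx0 (Or.inl rfl))
  have hy1 := hin y (hroot y hy0 (Or.inr rfl))
  obtain ⟨e1, e2, e3⟩ := powerSums hr hζ hζz hs hp
  have hX := setIntegral_log_eq_of_factorization hr ha har z hζ1 hx1 hy1
    (fun θ => by rw [← hζz]; exact log_norm_ratMap_sub hr hζ hζ1.ne hx1 hy1 hs hp θ)
    e1.symm e2.symm e3.symm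
  have h := scaledEnergy_cast r a t₁ z hX
  apply Complex.ofReal_injective
  rw [h, ht₁, equilibriumConstant]
  simp only [map_sub, map_div₀, map_mul, map_pow, Complex.conj_ofReal, map_ofNat, V]
  push_cast
  field_simp
  ring

/-- The excess of the total potential over its constant value at the image of `ρ u`. -/
def excess (r a : ℝ) (u : ℂ) (ρ : ℝ) : ℂ :=
  -2 * (r ^ 2 * (1 - 2 * r ^ 2 - 4 * a ^ 2)) * Real.log ρ +
    (-(r * u⁻¹ * ρ + 2 * a * r * u * (ρ : ℂ)⁻¹ + r ^ 2 * u ^ 2 * (ρ : ℂ)⁻¹ ^ 2) *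
        (r * u * ((ρ : ℂ)⁻¹ - ρ) - 2 * a * r * u⁻¹ * ((ρ : ℂ)⁻¹ - ρ)
          - r ^ 2 * u⁻¹ ^ 2 * ((ρ : ℂ)⁻¹ ^ 2 - ρ ^ 2))
      + (-2 * a * r ^ 3 * u - 4 * a * r ^ 3 * u⁻¹) * ((ρ : ℂ)⁻¹ - ρ)
      + (a * r ^ 2 * u ^ 2 - a * r ^ 2 * u⁻¹ ^ 2) * ((ρ : ℂ)⁻¹ ^ 2 - ρ ^ 2)
      + (r ^ 3 / 3 * u ^ 3 - 2 * r ^ 3 / 3 * u⁻¹ ^ 3) * ((ρ : ℂ)⁻¹ ^ 3 - ρ ^ 3))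

theorem scaledEnergy_ratMap {r a t₁ ρ : ℝ} (hr : 0 < r) (ha : 0 < a) (har : a + r < 1 / 2)
    (ht₁ : t₁ = a - a ^ 2 - 4 * a * r ^ 2) {u : ℂ} (hu : ‖u‖ = 1) (hρ : 1 < ρ) :
    (scaledEnergy r a t₁ (ratMap r a (ρ * u)) : ℂ) =
      equilibriumConstant r a t₁ + excess r a u ρ := by
  have hr' : (r : ℂ) ≠ 0 := by exact_mod_cast hr.ne'
  have hρ' : (ρ : ℂ) ≠ 0 := by exact_mod_cast (by linarith : ρ ≠ 0)
  have hu0 : u ≠ 0 := norm_pos_iff.1 (by rw [hu]; exact one_pos)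
  have hcu : conj u = u⁻¹ := by
    rw [Complex.inv_def, Complex.normSq_eq_norm_sq, hu]; simp
  set ζ : ℂ := ρ * u with hζdef
  have hζ : ζ ≠ 0 := mul_ne_zero hρ' hu0
  have hnζ : ‖ζ‖ = ρ := by
    rw [hζdef, norm_mul, hu, Complex.norm_real, Real.norm_of_nonneg (by linarith), mul_one]
  have hcζ : conj ζ = ρ * u⁻¹ := by rw [hζdef, map_mul, Complex.conj_ofReal, hcu]
  obtain ⟨x, y, hs, hp⟩ := exists_sum_prod (2 * a / ζ + r / ζ ^ 2) (-(r / ζ))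
  have hζ1 : 1 ≤ ‖ζ‖ := by rw [hnζ]; exact hρ.le
  have hζne : ‖ζ‖ ≠ 1 := by rw [hnζ]; exact hρ.ne'
  have hx1 := norm_lt_one_of_sum_prod hr ha har hζ1 hs hp
  have hy1 := norm_lt_one_of_sum_prod hr ha har hζ1 ((add_comm y x).trans hs)
    ((mul_comm y x).trans hp)
  have hb : ‖(conj ζ)⁻¹‖ < 1 := by
    rw [norm_inv, Complex.norm_conj, hnζ]; exact inv_lt_one_of_one_lt₀ hρ
  obtain ⟨e1, e2, e3⟩ := powerSums hr hζ rfl hs hp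
  have hX := setIntegral_log_eq_of_factorization hr ha har (ratMap r a ζ) hb hx1 hy1
    (C := Real.log r + Real.log ρ)
    (fun θ => by
      rw [log_norm_ratMap_sub hr hζ hζne hx1 hy1 hs hp θ, log_norm_one_sub_reflect hζ hζne, hnζ]
      ring)
    -- Each power sum is that of the full fibre with `ζ` replaced by its reflection `1/conj ζ`.
    (p₁ := (ratMap r a ζ - a) / r - ζ + (conj ζ)⁻¹)
    (p₂ := ((ratMap r a ζ - a) / r) ^ 2 - 4 * a - ζ ^ 2 + (conj ζ)⁻¹ ^ 2)
    (p₃ := ((ratMap r a ζ - a) / r) ^ 3 - 6 * a * ((ratMap r a ζ - a) / r) - 3 * r - ζ ^ 3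
      + (conj ζ)⁻¹ ^ 3)
    (by rw [← e1]; ring) (by rw [← e2]; ring) (by rw [← e3]; ring)
  have h := scaledEnergy_cast r a t₁ _ hX
  have hcr : conj (ratMap r a ζ) = ratMap r a (ρ * u⁻¹) := by
    rw [← hcζ]; simp [ratMap, map_ofNat]
  have hd : ratMap r a (ρ * u⁻¹) = a +
      (r * u⁻¹ * ρ + 2 * a * r * u * (ρ : ℂ)⁻¹ + r ^ 2 * u ^ 2 * (ρ : ℂ)⁻¹ ^ 2) := by
    unfold ratMap; field_simp; ring
  rw [h, ht₁, equilibriumConstant, excess]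
  simp only [map_sub, map_add, map_div₀, map_mul, map_pow, Complex.conj_ofReal, map_ofNat, V,
    map_inv₀, hcr, hcζ, hcu, inv_inv]
  -- The remaining identity holds with the point and its conjugate as independent variables.
  generalize ratMap r a ζ = z
  have hd' : r * u⁻¹ * ρ + 2 * a * r * u * (ρ : ℂ)⁻¹ + r ^ 2 * u ^ 2 * (ρ : ℂ)⁻¹ ^ 2 =
      ratMap r a (ρ * u⁻¹) - a := by rw [hd]; ring
  rw [hd']
  generalize ratMap r a (ρ * u⁻¹) = z'
  rw [hζdef]
  push_cast
  field_simp
  ring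

/-! ### Positivity of the excess outside of the droplet -/

/-- Up to the factor `ρ - 1/ρ`, this is `(conj h(ρu) - h(1/(ρu))) u h'(ρu)`; the first bracket comes
from the difference, the second from `h'`. -/
def excessSlope (r a : ℝ) (u : ℂ) (ρ : ℝ) : ℂ :=
  r ^ 2 * ((1 - 2 * a * u ^ 2 - r * (ρ + (ρ : ℂ)⁻¹) * u ^ 3) *
    (1 - 2 * a * (ρ : ℂ)⁻¹ ^ 2 * conj u ^ 2 - 2 * r * (ρ : ℂ)⁻¹ ^ 3 * conj u ^ 3))

lemma conj_eq_inv_of_norm_eq_one {u : ℂ} (hu : ‖u‖ = 1) : conj u = u⁻¹ := by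
  rw [Complex.inv_def, Complex.normSq_eq_norm_sq, hu]; simp

lemma hasDerivAt_excess (r a : ℝ) {u : ℂ} (hu : ‖u‖ = 1) {ρ : ℝ} (hρ : 0 < ρ) :
    HasDerivAt (excess r a u)
      ((ρ - (ρ : ℂ)⁻¹) * (excessSlope r a u ρ + conj (excessSlope r a u ρ))) ρ := by
  have hρ' : (ρ : ℂ) ≠ 0 := by exact_mod_cast hρ.ne'
  have hu0 : u ≠ 0 := norm_pos_iff.1 (by rw [hu]; exact one_pos)
  have hlog := ((Real.hasDerivAt_log hρ.ne').ofReal_comp).const_mul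
    (-2 * (r ^ 2 * (1 - 2 * r ^ 2 - 4 * a ^ 2)) : ℂ)
  have hx : HasDerivAt (fun x : ℂ => x) 1 (ρ : ℂ) := hasDerivAt_id _
  have hy := hasDerivAt_inv hρ'
  have hD := ((hx.const_mul (r * u⁻¹)).add (hy.const_mul (2 * a * r * u))).add
    ((hy.fun_pow 2).const_mul (r ^ 2 * u ^ 2))
  have h1 := hy.sub hx
  have h2 := (hy.fun_pow 2).sub (hx.fun_pow 2)
  have h3 := (hy.fun_pow 3).sub (hx.fun_pow 3)
  have hB := ((h1.const_mul (r * u)).sub (h1.const_mul (2 * a * r * u⁻¹))).sub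
    (h2.const_mul (r ^ 2 * u⁻¹ ^ 2))
  have hrat := ((((hD.neg).mul hB).add
    (h1.const_mul (-2 * a * r ^ 3 * u - 4 * a * r ^ 3 * u⁻¹))).add
    (h2.const_mul (a * r ^ 2 * u ^ 2 - a * r ^ 2 * u⁻¹ ^ 2))).add
    (h3.const_mul (r ^ 3 / 3 * u ^ 3 - 2 * r ^ 3 / 3 * u⁻¹ ^ 3))
  have hall := hlog.add hrat.comp_ofReal
  refine (hall.congr_of_eventuallyEq (Filter.Eventually.of_forall fun x => ?_)).congr_deriv ?_
  · simp only [excess, Pi.add_apply, Pi.sub_apply, Pi.mul_apply, Pi.neg_apply]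
  · simp only [excessSlope, map_add, map_sub, map_mul, map_pow, map_inv₀, Complex.conj_ofReal,
      map_one, map_ofNat, conj_eq_inv_of_norm_eq_one hu, Pi.add_apply,
      Pi.sub_apply, Pi.neg_apply, inv_inv]
    push_cast
    field_simp
    ring

/-- At `ρ = 1` the two brackets are conjugate, so the slope is `r²|A|²`; `A = 0` would force `1 ≤ 2a
+ 2r`. -/
lemma excessSlope_one_re_pos {r a : ℝ} (hr : 0 < r) (ha : 0 < a) (har : a + r < 1 / 2) {u : ℂ}
    (hu : ‖u‖ = 1) : 0 < (excessSlope r a u 1).re := by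
  set A : ℂ := 1 - 2 * a * u ^ 2 - 2 * r * u ^ 3 with hA
  have e : excessSlope r a u 1 = ((r ^ 2 * ‖A‖ ^ 2 : ℝ) : ℂ) := by
    push_cast
    rw [← Complex.mul_conj', hA, excessSlope]
    simp only [map_sub, map_mul, map_pow, map_one, map_ofNat, Complex.conj_ofReal,
      Complex.ofReal_one, inv_one, one_pow, mul_one]
    ring
  have hA0 : A ≠ 0 := by
    intro h
    have h1 : (1 : ℂ) = 2 * a * u ^ 2 + 2 * r * u ^ 3 := by linear_combination h
    have h2 : (1 : ℝ) ≤ 2 * a + 2 * r := by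
      have := congrArg norm h1
      rw [norm_one] at this
      rw [this]
      refine (norm_add_le _ _).trans (le_of_eq ?_)
      simp [hu, abs_of_pos hr, abs_of_pos ha]
    linarith
  rw [e, Complex.ofReal_re]
  positivity

lemma exists_excessSlope_re_pos {r a : ℝ} (hr : 0 < r) (ha : 0 < a) (har : a + r < 1 / 2) :
    ∃ ε > 0, ∀ ρ : ℝ, |ρ - 1| < ε → ∀ u : ℂ, ‖u‖ = 1 → 0 < (excessSlope r a u ρ).re := by
  have hev : ∀ᶠ ρ in 𝓝 (1 : ℝ), ∀ u ∈ Metric.sphere (0 : ℂ) 1, 0 < (excessSlope r a u ρ).re := by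
    -- Compactness of the circle makes the width of the collar independent of `u`.
    refine (isCompact_sphere (0 : ℂ) 1).eventually_forall_of_forall_eventually fun u hu => ?_
    have hc : ContinuousAt (fun q : ℝ × ℂ => (excessSlope r a q.2 q.1).re) (1, u) := by
      refine Complex.continuous_re.continuousAt.comp ?_
      have hi : ContinuousAt (fun q : ℝ × ℂ => ((q.1 : ℂ))⁻¹) (1, u) :=
        ContinuousAt.inv₀ (by fun_prop) (by simp)
      have hcj := Complex.continuous_conj
      unfold excessSlope
      fun_prop
    exact hc.eventually_const_lt
      (excessSlope_one_re_pos hr ha har (by simpa using hu))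
  obtain ⟨ε, hε, h⟩ := Metric.eventually_nhds_iff.1 hev
  exact ⟨ε, hε, fun ρ hρ u hu => h (by rwa [Real.dist_eq]) u (by simpa using hu)⟩

theorem exists_excess_re_pos {r a : ℝ} (hr : 0 < r) (ha : 0 < a) (har : a + r < 1 / 2) :
    ∃ ε > 0, ∀ ρ : ℝ, 1 < ρ → ρ < 1 + ε → ∀ u : ℂ, ‖u‖ = 1 → 0 < (excess r a u ρ).re := by
  obtain ⟨ε, hε, h⟩ := exists_excessSlope_re_pos hr ha har
  refine ⟨ε, hε, fun ρ hρ1 hρ u hu => ?_⟩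
  have hd : ∀ x : ℝ, 0 < x → HasDerivAt (fun x => (excess r a u x).re)
      ((x - x⁻¹) * (2 * (excessSlope r a u x).re)) x := by
    intro x hx
    have := Complex.reCLM.hasFDerivAt.comp_hasDerivAt x (hasDerivAt_excess r a hu hx)
    refine this.congr_deriv ?_
    rw [Complex.reCLM_apply, Complex.add_conj, ← Complex.ofReal_inv, ← Complex.ofReal_sub,
      ← Complex.ofReal_mul, Complex.ofReal_re]
  have hmono : StrictMonoOn (fun x => (excess r a u x).re) (Set.Icc 1 ρ) := by
    refine strictMonoOn_of_deriv_pos (convex_Icc 1 ρ) (fun x hx =>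
      (hd x (by linarith [hx.1])).continuousAt.continuousWithinAt) fun x hx => ?_
    rw [interior_Icc] at hx
    have hx0 : 0 < x := by linarith [hx.1]
    rw [(hd x hx0).deriv]
    have h1 : x⁻¹ < 1 := inv_lt_one_of_one_lt₀ hx.1
    have h2 := h x (by rw [abs_of_pos (by linarith [hx.1])]; linarith [hx.2]) u hu
    have h3 : 0 < x - x⁻¹ := by linarith [hx.1]
    positivity
  have h1 := hmono (Set.left_mem_Icc.2 hρ1.le) (Set.right_mem_Icc.2 hρ1.le) hρ1
  have h0 : (excess r a u 1).re = 0 := by simp [excess]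
  simpa [h0] using h1

/-! ### The main theorem -/

lemma Ω_eq_harmMap_image {t₀ t₁ : ℝ} (hr : 0 < r t₀ t₁) (ha : 0 < a₀ t₀ t₁)
    (har : a₀ t₀ t₁ + r t₀ t₁ < 1 / 2) :
    Ω t₀ t₁ = harmMap (r t₀ t₁) (a₀ t₀ t₁) '' Metric.ball 0 1 := by
  rw [Ω_eq hr ha har]
  exact Set.image_congr fun w hw => by
    rw [glueHomeo_apply, glueMap_of_norm_le (mem_ball_zero_iff.1 hw).le]

lemma logPotential_μ₀ {t₀ : ℝ} (t₁ : ℝ) (ht₀ : 0 < t₀) (z : ℂ) :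
    logPotential (μ₀ t₀ t₁) z =
      -(1 / (Real.pi * t₀)) * ∫ s in Ω t₀ t₁, Real.log ‖s - z‖ := by
  have h : 0 ≤ 1 / (Real.pi * t₀) := by positivity
  rw [logPotential, μ₀, integral_smul_measure, ENNReal.toReal_ofReal h, smul_eq_mul]
  simp only [one_div, Real.log_inv, integral_neg]
  ring

lemma energy_eq {t₀ t₁ : ℝ} (ht₀ : 0 < t₀) {r a : ℝ}
    (hΩ : Ω t₀ t₁ = harmMap r a '' Metric.ball 0 1) (z : ℂ) :
    2 * logPotential (μ₀ t₀ t₁) z + externalField t₀ t₁ z = 1 / t₀ * scaledEnergy r a t₁ z := by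
  rw [logPotential_μ₀ t₁ ht₀, hΩ, externalField, scaledEnergy]
  have := Real.pi_ne_zero
  field_simp

end CubicModel

end

theorem mainTheorem6 (t₀ t₁ : ℝ) (ht : (t₀, t₁) ∈ CubicModel.phaseDomain) :
    (∀ z : ℂ, Integrable (fun s : ℂ => Real.log (1 / ‖s - z‖)) (CubicModel.μ₀ t₀ t₁)) ∧
    ∃ (D : Set ℂ) (l : ℝ), IsOpen D ∧ closure (CubicModel.Ω t₀ t₁) ⊆ D ∧
      (∀ z ∈ closure (CubicModel.Ω t₀ t₁),
        2 * CubicModel.logPotential (CubicModel.μ₀ t₀ t₁) z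
          + CubicModel.externalField t₀ t₁ z = l) ∧
      (∀ z ∈ D \ closure (CubicModel.Ω t₀ t₁),
        l < 2 * CubicModel.logPotential (CubicModel.μ₀ t₀ t₁) z
          + CubicModel.externalField t₀ t₁ z) := by
  open CubicModel in
  have ht₀ : 0 < t₀ := ht.1
  obtain ⟨hr, ha, har, ht₁, -⟩ := param_spec ht
  have hΩ := Ω_eq_harmMap_image hr ha har
  have hΩΦ := Ω_eq hr ha har
  have hE := energy_eq (t₁ := t₁) ht₀ hΩ
  set Φ := glueHomeo hr ha har with hΦ
  have hcl : closure (Ω t₀ t₁) = Φ '' Metric.closedBall 0 1 := by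
    rw [hΩΦ, ← Φ.image_closure, closure_ball (0 : ℂ) one_ne_zero]
  refine ⟨fun z => ?_, ?_⟩
  · have h := (integrableOn_log_norm_sub
      (isBounded_harmMap_image (r t₀ t₁) (a₀ t₀ t₁)) z).neg
    rw [← hΩ] at h
    refine Integrable.smul_measure ?_ ENNReal.ofReal_ne_top
    refine h.congr (Filter.Eventually.of_forall fun s => ?_)
    simp
  obtain ⟨ε, hε, hpos⟩ := exists_excess_re_pos hr ha har
  -- The neighborhood is the image of a slightly larger disc; its part off the closure is covered by
  -- `h(ρu)` with `1 < ρ < 1 + ε`.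
  refine ⟨Φ '' Metric.ball 0 (1 + ε), 1 / t₀ * equilibriumConstant (r t₀ t₁) (a₀ t₀ t₁) t₁,
    Φ.isOpenMap _ Metric.isOpen_ball, ?_, ?_, ?_⟩
  · rw [hcl]
    exact Set.image_mono (Metric.closedBall_subset_ball (by linarith))
  · intro z hz
    rw [hE]
    congr 1
    have hclosed : IsClosed {z | scaledEnergy (r t₀ t₁) (a₀ t₀ t₁) t₁ z =
        equilibriumConstant (r t₀ t₁) (a₀ t₀ t₁) t₁} :=
      isClosed_eq (continuous_scaledEnergy hr ha har t₁) continuous_const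
    refine closure_minimal (fun w hw => ?_) hclosed hz
    rw [hΩ] at hw
    exact scaledEnergy_of_mem hr ha har ht₁ hw
  · rintro z ⟨⟨ζ, hζ, rfl⟩, hz⟩
    rw [hcl, Φ.injective.mem_set_image, mem_closedBall_zero_iff, not_le] at hz
    rw [mem_ball_zero_iff] at hζ
    have hζ0 : (‖ζ‖ : ℂ) ≠ 0 := by exact_mod_cast (by linarith : ‖ζ‖ ≠ 0)
    have hu : ‖ζ / ‖ζ‖‖ = 1 := by
      rw [norm_div, Complex.norm_real, norm_norm, div_self (by linarith)]
    have h1 := scaledEnergy_ratMap hr ha har ht₁ hu hz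
    rw [mul_div_cancel₀ _ hζ0, ← glueMap_of_le_norm hz.le] at h1
    have h2 := congrArg Complex.re h1
    rw [Complex.add_re, Complex.ofReal_re, Complex.ofReal_re] at h2
    rw [hE, hΦ, glueHomeo_apply, h2]
    have h3 := hpos ‖ζ‖ hz hζ _ hu
    exact mul_lt_mul_of_pos_left (by linarith) (by positivity)
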